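/- An $\infty$-graph is a presheaf of sets on the globe category, i.e. sets $X_m$ ($m\in\mathbb N$) of $m$-cells with iterated sources and targets $s^m_p,t^m_p:X_m\to X_p$ ($p<m$) satisfying the globular identities; $\infty\text{-}\mathbb{G}\mathrm{r}$ is the category of $\infty$-graphs. An $\infty$-magma is an $\infty$-graph with reflexors $1^m_{m+1}:X_m\to X_{m+1}$ such that $s^{m+1}_m1^m_{m+1}(x)=t^{m+1}_m1^m_{m+1}(x)=x$ (with iterates $1^p_m$) and compositions $y\circ^m_p x\in X_m$, defined for $m$-cells with $s^m_p(y)=t^m_p(x)$, such that $s^m_p(y\circ^m_px)=s^m_p(x)$, $t^m_p(y\circ^m_px)=t^m_p(y)$, and $s^m_q(y\circ^m_px)=s^m_q(y)\circ^q_ps^m_q(x)$, $t^m_q(y\circ^m_px)=t^m_q(y)\circ^q_pt^m_q(x)$ for $p<q<m$. A strict $\infty$-category is an $\infty$-magma in which each $\circ^m_p$ is associative with units $1^p_m$, the interchange laws hold, and $1^m_{m+1}(y\circ^m_px)=1^m_{m+1}(y)\circ^{m+1}_p1^m_{m+1}(x)$. Let $n\in\mathbb N\cup\{\infty\}$. An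 $(\infty,n)$-magma is an $\infty$-magma with specified maps (reversors) $j^m_p:X_m\to X_m$ for $n\le p<m$ such that $s^{m}_{m-1}j^{m}_p=j^{m-1}_ps^{m}_{m-1}$ and $t^{m}_{m-1}j^{m}_p=j^{m-1}_pt^{m}_{m-1}$ for $p<m-1$, while $s^{p+1}_pj^{p+1}_p=t^{p+1}_p$ and $t^{p+1}_pj^{p+1}_p=s^{p+1}_p$; morphisms are the morphisms of $\infty$-graphs that preserve reflexors, compositions and reversors. A strict $(\infty,n)$-category is a strict $\infty$-category in which every $m$-cell $\alpha$ has, for all $n\le p<m$, a $\circ^m_p$-inverse $\beta$, i.e. $\alpha\circ^m_p\beta=1^p_m(t^m_p\alpha)$ and $\beta\circ^m_p\alpha=1^p_m(s^m_p\alpha)$; such inverses are unique, and they make it an $(\infty,n)$-magma. An $(\infty,n)$-categorical stretching $(M,C,\pi,[-,-])$ consists of an $(\infty,n)$-magma $M$, a strict $(\infty,n)$-category $C$, a morphism $\pi:M\to C$ of $(\infty,n)$-magmas, and, for all $m\ge 0$ and all parallel $m$-cells $c_1,c_0$ of $M$ (same source and same target in dimension $m-1$ if $m\ge1$; no condition if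 $m=0$) with $\pi(c_1)=\pi(c_0)$, an $(m+1)$-cell $[c_1,c_0]_m$ of $M$ with $t^{m+1}_m[c_1,c_0]_m=c_1$, $s^{m+1}_m[c_1,c_0]_m=c_0$, $\pi([c_1,c_0]_m)=1^m_{m+1}(\pi(c_1))$ and $[c,c]_m=1^m_{m+1}(c)$. Morphisms are commutative squares of morphisms of $(\infty,n)$-magmas whose upper morphism preserves the brackets. For $n=\infty$ there are no reversors and no invertibility conditions, and these are Penon's categorical stretchings. Let $(\infty,n)\text{-}\mathbb{E}\mathrm{t}\mathbb{C}\mathrm{at}$ be the resulting category, and $\mathcal U_n:(\infty,n)\text{-}\mathbb{E}\mathrm{t}\mathbb{C}\mathrm{at}\to\infty\text{-}\mathbb{G}\mathrm{r}$ the forgetful functor that sends $(M,C,\pi,[-,-])$ to the $\infty$-graph underlying $M$. **Theorem.** (i) For every $n\in\mathbb N\cup\{\infty\}$ the functor $\mathcal U_n$ has a left adjoint. Let $\mathbb T^n$ be the monad on $\infty\text{-}\mathbb{G}\mathrm{r}$ generated by an adjunction $\mathcal F_n\dashv\mathcal U_n$; weak $(\infty,n)$-categories are the $\mathbb T^n$-algebras,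 and $\mathbb T^P:=\mathbb T^\infty$ is Penon's monad for weak $\infty$-categories. (ii) For $n\le n'$ the functor $(\infty,n)\text{-}\mathbb{E}\mathrm{t}\mathbb{C}\mathrm{at}\to(\infty,n')\text{-}\mathbb{E}\mathrm{t}\mathbb{C}\mathrm{at}$ over $\infty\text{-}\mathbb{G}\mathrm{r}$ that forgets the reversors $j^m_p$ with $n\le p<n'$ induces a morphism of monads $\theta:\mathbb T^{n'}\to\mathbb T^n$, and hence a forgetful functor $\mathbb{A}\mathrm{lg}(\mathbb T^n)\to\mathbb{A}\mathrm{lg}(\mathbb T^{n'})$, $(G,v)\mapsto(G,v\circ\theta_G)$. For every $n\in\mathbb N$, the functors so obtained, $$V_n:\mathbb{A}\mathrm{lg}(\mathbb T^n)\to\mathbb{A}\mathrm{lg}(\mathbb T^{n+1})\quad\text{and}\quad V:\mathbb{A}\mathrm{lg}(\mathbb T^n)\to\mathbb{A}\mathrm{lg}(\mathbb T^P),$$ commute with the forgetful functors to $\infty\text{-}\mathbb{G}\mathrm{r}$ and have left adjoints: $L_n\dashv V_n$ and $L\dashv V$. -/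

import Mathlib

open CategoryTheory Opposite

universe u

namespace WeakCat

/-! ### The globe category and `∞`-graphs -/

/-- The globe category: one object for every natural number. -/
structure Globe where
  /-- the dimension of the globe -/
  dim : ℕ

/-- Morphisms of the globe category: besides identities there are, for `p < m`, exactly two
morphisms `p ⟶ m`, namely the iterated cosource and the iterated cotarget. -/
inductive Globe.Hom : ℕ → ℕ → Type
  | id (m : ℕ) : Globe.Hom m m
  | src {p m : ℕ} (h : p < m) : Globe.Hom p m
  | tgt {p m : ℕ} (h : p < m) : Globe.Hom p m

/-- Composition (in diagrammatic order): the first non-identity factor decides whether the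
composite is a cosource or a cotarget. -/
def Globe.Hom.comp : {p q m : ℕ} → Globe.Hom p q → Globe.Hom q m → Globe.Hom p m
  | _, _, _, .id _, g => g
  | _, _, _, .src h, .id _ => .src h
  | _, _, _, .src h, .src h' => .src (h.trans h')
  | _, _, _, .src h, .tgt h' => .src (h.trans h')
  | _, _, _, .tgt h, .id _ => .tgt h
  | _, _, _, .tgt h, .src h' => .tgt (h.trans h')
  | _, _, _, .tgt h, .tgt h' => .tgt (h.trans h')

instance : SmallCategory Globe where
  Hom a b := Globe.Hom a.dim b.dim
  id a := Globe.Hom.id a.dim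
  comp f g := Globe.Hom.comp f g
  id_comp _ := rfl
  comp_id {a b} f := by
    obtain ⟨a⟩ := a
    obtain ⟨b⟩ := b
    dsimp at f
    cases f <;> rfl
  assoc {a b c d} f g h := by
    obtain ⟨a⟩ := a
    obtain ⟨b⟩ := b
    obtain ⟨c⟩ := c
    obtain ⟨d⟩ := d
    dsimp at f g h
    cases f <;> cases g <;> cases h <;> rfl

/-- The cosource `p ⟶ m` in the globe category. -/
def Globe.src {p m : ℕ} (h : p < m) : (Globe.mk p) ⟶ (Globe.mk m) := Globe.Hom.src h

/-- The cotarget `p ⟶ m` in the globe category. -/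
def Globe.tgt {p m : ℕ} (h : p < m) : (Globe.mk p) ⟶ (Globe.mk m) := Globe.Hom.tgt h

/-- The category `∞-Gr` of `∞`-graphs (globular sets): presheaves on the globe category. -/
abbrev InfGraph : Type (u + 1) := Globeᵒᵖ ⥤ Type u

namespace InfGraph

variable {X Y : InfGraph.{u}}

/-- The set of `m`-cells. -/
def Cell (X : InfGraph.{u}) (m : ℕ) : Type u := X.obj (op (Globe.mk m))

/-- The iterated source `s^m_p`. -/
def s {p m : ℕ} (h : p < m) (x : X.Cell m) : X.Cell p := X.map (Globe.src h).op x

/-- The iterated target `t^m_p`. -/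
def t {p m : ℕ} (h : p < m) (x : X.Cell m) : X.Cell p := X.map (Globe.tgt h).op x

/-- The action of a morphism of `∞`-graphs on `m`-cells. -/
def app (f : X ⟶ Y) {m : ℕ} (x : X.Cell m) : Y.Cell m := f.app (op (Globe.mk m)) x

theorem s_s {p q m : ℕ} (h : p < q) (h' : q < m) (x : X.Cell m) :
    s h (s h' x) = s (h.trans h') x :=
  (ConcreteCategory.congr_hom (X.map_comp (Globe.src h').op (Globe.src h).op) x).symm

theorem s_t {p q m : ℕ} (h : p < q) (h' : q < m) (x : X.Cell m) :
    s h (t h' x) = s (h.trans h') x :=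
  (ConcreteCategory.congr_hom (X.map_comp (Globe.tgt h').op (Globe.src h).op) x).symm

theorem t_s {p q m : ℕ} (h : p < q) (h' : q < m) (x : X.Cell m) :
    t h (s h' x) = t (h.trans h') x :=
  (ConcreteCategory.congr_hom (X.map_comp (Globe.src h').op (Globe.tgt h).op) x).symm

theorem t_t {p q m : ℕ} (h : p < q) (h' : q < m) (x : X.Cell m) :
    t h (t h' x) = t (h.trans h') x :=
  (ConcreteCategory.congr_hom (X.map_comp (Globe.tgt h').op (Globe.tgt h).op) x).symm

theorem app_s (f : X ⟶ Y) {p m : ℕ} (h : p < m) (x : X.Cell m) :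
    s h (app f x) = app f (s h x) :=
  (NatTrans.naturality_apply f (Globe.src h).op x).symm

theorem app_t (f : X ⟶ Y) {p m : ℕ} (h : p < m) (x : X.Cell m) :
    t h (app f x) = app f (t h x) :=
  (NatTrans.naturality_apply f (Globe.tgt h).op x).symm

/-- Two `m`-cells are parallel if they have the same source and the same target in dimension
`m - 1`; any two `0`-cells are parallel. -/
def Parallel : {m : ℕ} → X.Cell m → X.Cell m → Prop
  | 0, _, _ => True
  | m + 1, c₁, c₀ => t (Nat.lt_succ_self m) c₁ = t (Nat.lt_succ_self m) c₀ ∧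
      s (Nat.lt_succ_self m) c₁ = s (Nat.lt_succ_self m) c₀

theorem Parallel.map (f : X ⟶ Y) : ∀ {m : ℕ} {c₁ c₀ : X.Cell m}, Parallel c₁ c₀ →
    Parallel (app f c₁) (app f c₀)
  | 0, _, _, _ => trivial
  | m + 1, c₁, c₀, h => by
    obtain ⟨h₁, h₂⟩ := h
    exact ⟨by rw [app_t, app_t, h₁], by rw [app_s, app_s, h₂]⟩

end InfGraph

open InfGraph

/-! ### `∞`-magmas -/

/-- An `∞`-magma: a reflexive `∞`-graph with compositions
`y ∘^m_p x`, defined for `m`-cells with `s^m_p y = t^m_p x`, that satisfy the positional axioms and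
nothing else. -/
structure Magma where
  /-- the underlying `∞`-graph -/
  graph : InfGraph.{u}
  /-- the reflexors `1^m_{m+1}` -/
  refl {m : ℕ} (x : graph.Cell m) : graph.Cell (m + 1)
  s_refl {m : ℕ} (x : graph.Cell m) : s (Nat.lt_succ_self m) (refl x) = x
  t_refl {m : ℕ} (x : graph.Cell m) : t (Nat.lt_succ_self m) (refl x) = x
  /-- the composition `y ∘^m_p x` -/
  comp {p m : ℕ} (h : p < m) (y x : graph.Cell m) (e : s h y = t h x) : graph.Cell m
  s_comp {p m : ℕ} (h : p < m) (y x : graph.Cell m) (e : s h y = t h x) :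
    s h (comp h y x e) = s h x
  t_comp {p m : ℕ} (h : p < m) (y x : graph.Cell m) (e : s h y = t h x) :
    t h (comp h y x e) = t h y
  s_comp_of_lt {p q m : ℕ} (h : p < q) (h' : q < m) (y x : graph.Cell m)
    (e : s (h.trans h') y = t (h.trans h') x) :
    s h' (comp (h.trans h') y x e) =
      comp h (s h' y) (s h' x) ((s_s h h' y).trans (e.trans (t_s h h' x).symm))
  t_comp_of_lt {p q m : ℕ} (h : p < q) (h' : q < m) (y x : graph.Cell m)
    (e : s (h.trans h') y = t (h.trans h') x) :
    t h' (comp (h.trans h') y x e) =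
      comp h (t h' y) (t h' x) ((s_t h h' y).trans (e.trans (t_t h h' x).symm))

namespace Magma

variable {M : Magma.{u}}

/-- The iterated reflexor `1^p_m`. -/
def reflTo {p m : ℕ} (h : p < m) (x : M.graph.Cell p) : M.graph.Cell m :=
  Nat.leRec (motive := fun k _ => M.graph.Cell k) (M.refl x) (fun _ _ y => M.refl y) h

theorem reflTo_self {p : ℕ} (x : M.graph.Cell p) : reflTo (Nat.lt_succ_self p) x = M.refl x :=
  Nat.leRec_self _ _

theorem reflTo_succ {p m : ℕ} (h : p < m) (x : M.graph.Cell p) :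
    reflTo (h.trans (Nat.lt_succ_self m)) x = M.refl (reflTo h x) :=
  Nat.leRec_succ _ _ _

theorem s_reflTo {p m : ℕ} (h : p < m) (x : M.graph.Cell p) : s h (reflTo h x) = x := by
  induction m, h using Nat.le_induction with
  | base => rw [reflTo_self, M.s_refl]
  | succ m h ih =>
    rw [reflTo_succ (m := m) h, ← s_s (X := M.graph) h (Nat.lt_succ_self m), M.s_refl]
    exact ih

theorem t_reflTo {p m : ℕ} (h : p < m) (x : M.graph.Cell p) : t h (reflTo h x) = x := by
  induction m, h using Nat.le_induction with
  | base => rw [reflTo_self, M.t_refl]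
  | succ m h ih =>
    rw [reflTo_succ (m := m) h, ← t_t (X := M.graph) h (Nat.lt_succ_self m), M.t_refl]
    exact ih

theorem comp_congr {p m : ℕ} (h : p < m) {y y' x x' : M.graph.Cell m} (hy : y = y') (hx : x = x')
    (e : s h y = t h x) : M.comp h y x e = M.comp h y' x' (hy ▸ hx ▸ e) := by
  subst hy hx
  rfl

theorem s_comp_of_gt {q p m : ℕ} (h : q < p) (h' : p < m) (y x : M.graph.Cell m)
    (e : s h' y = t h' x) : s (h.trans h') (M.comp h' y x e) = s (h.trans h') x := by
  rw [← s_s h h', M.s_comp, s_s]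

theorem t_comp_of_gt {q p m : ℕ} (h : q < p) (h' : p < m) (y x : M.graph.Cell m)
    (e : s h' y = t h' x) : t (h.trans h') (M.comp h' y x e) = t (h.trans h') y := by
  rw [← t_t h h', M.t_comp, t_t]

/-- The composites occurring in the interchange law are composable. -/
theorem interchange_aux₁ {q p m : ℕ} (h : q < p) (h' : p < m) {y' y x' x : M.graph.Cell m}
    (e₁ : s h' y' = t h' y) (e₂ : s h' x' = t h' x)
    (e₃ : s (h.trans h') y' = t (h.trans h') x') :
    s (h.trans h') (M.comp h' y' y e₁) = t (h.trans h') (M.comp h' x' x e₂) := by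
  rw [s_comp_of_gt h h', t_comp_of_gt h h', ← e₃, ← s_t h h', ← e₁, s_s h h']

/-- The composites occurring in the interchange law are composable. -/
theorem interchange_aux₂ {q p m : ℕ} (h : q < p) (h' : p < m) {y' y x' x : M.graph.Cell m}
    (e₁ : s h' y' = t h' y) (e₂ : s h' x' = t h' x)
    (e₃ : s (h.trans h') y' = t (h.trans h') x') (e₄ : s (h.trans h') y = t (h.trans h') x) :
    s h' (M.comp (h.trans h') y' x' e₃) = t h' (M.comp (h.trans h') y x e₄) := by
  rw [M.s_comp_of_lt, M.t_comp_of_lt]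
  exact comp_congr h e₁ e₂ _

/-- The axioms of a strict `∞`-category. -/
structure IsStrict (M : Magma.{u}) : Prop where
  comp_assoc {p m : ℕ} (h : p < m) (z y x : M.graph.Cell m) (e : s h z = t h y)
    (e' : s h y = t h x) :
    M.comp h (M.comp h z y e) x ((M.s_comp h z y e).trans e') =
      M.comp h z (M.comp h y x e') (e.trans (M.t_comp h y x e').symm)
  refl_comp {p m : ℕ} (h : p < m) (x : M.graph.Cell m) :
    M.comp h (reflTo h (t h x)) x (s_reflTo h _) = x
  comp_refl {p m : ℕ} (h : p < m) (x : M.graph.Cell m) :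
    M.comp h x (reflTo h (s h x)) (t_reflTo h _).symm = x
  interchange {q p m : ℕ} (h : q < p) (h' : p < m) (y' y x' x : M.graph.Cell m)
    (e₁ : s h' y' = t h' y) (e₂ : s h' x' = t h' x)
    (e₃ : s (h.trans h') y' = t (h.trans h') x') (e₄ : s (h.trans h') y = t (h.trans h') x) :
    M.comp (h.trans h') (M.comp h' y' y e₁) (M.comp h' x' x e₂) (interchange_aux₁ h h' e₁ e₂ e₃) =
      M.comp h' (M.comp (h.trans h') y' x' e₃) (M.comp (h.trans h') y x e₄)
        (interchange_aux₂ h h' e₁ e₂ e₃ e₄)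
  refl_of_comp {p m : ℕ} (h : p < m) (y x : M.graph.Cell m) (e : s h y = t h x) :
    M.refl (M.comp h y x e) =
      M.comp (h.trans (Nat.lt_succ_self m)) (M.refl y) (M.refl x)
        (by rw [← s_s h (Nat.lt_succ_self m), ← t_t h (Nat.lt_succ_self m), M.s_refl, M.t_refl, e])

/-- `β` is a `∘^m_p`-inverse of `α`. -/
def IsInverse {p m : ℕ} (h : p < m) (α β : M.graph.Cell m) : Prop :=
  ∃ (e : s h α = t h β) (e' : s h β = t h α),
    M.comp h α β e = reflTo h (t h α) ∧ M.comp h β α e' = reflTo h (s h α)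

theorem IsInverse.unique (hM : M.IsStrict) {p m : ℕ} {h : p < m} {α β β' : M.graph.Cell m}
    (hβ : IsInverse h α β) (hβ' : IsInverse h α β') : β = β' := by
  obtain ⟨e₁, e₂, -, e₄⟩ := hβ
  obtain ⟨f₁, f₂, f₃, -⟩ := hβ'
  calc β = M.comp h β (reflTo h (s h β)) (t_reflTo h _).symm := (hM.comp_refl h β).symm
    _ = M.comp h β (M.comp h α β' f₁) (e₂.trans (M.t_comp h α β' f₁).symm) :=
        comp_congr h rfl (by rw [f₃, e₂]) _
    _ = M.comp h (M.comp h β α e₂) β' ((M.s_comp h β α e₂).trans f₁) :=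
        (hM.comp_assoc h β α β' e₂ f₁).symm
    _ = M.comp h (reflTo h (t h β')) β' (s_reflTo h _) := comp_congr h (by rw [e₄, f₁]) rfl _
    _ = β' := hM.refl_comp h β'

theorem IsInverse.s {p m : ℕ} {h : p < m} {α β : M.graph.Cell (m + 1)}
    (hβ : IsInverse (h.trans (Nat.lt_succ_self m)) α β) :
    IsInverse h (s (Nat.lt_succ_self m) α) (s (Nat.lt_succ_self m) β) := by
  obtain ⟨e₁, e₂, e₃, e₄⟩ := hβ
  refine ⟨by rw [s_s, t_s, e₁], by rw [s_s, t_s, e₂], ?_, ?_⟩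
  · have := congrArg (InfGraph.s (Nat.lt_succ_self m)) e₃
    rw [M.s_comp_of_lt h, reflTo_succ h, M.s_refl] at this
    rw [this, t_s]
  · have := congrArg (InfGraph.s (Nat.lt_succ_self m)) e₄
    rw [M.s_comp_of_lt h, reflTo_succ h, M.s_refl] at this
    rw [this, s_s]

theorem IsInverse.t {p m : ℕ} {h : p < m} {α β : M.graph.Cell (m + 1)}
    (hβ : IsInverse (h.trans (Nat.lt_succ_self m)) α β) :
    IsInverse h (t (Nat.lt_succ_self m) α) (t (Nat.lt_succ_self m) β) := by
  obtain ⟨e₁, e₂, e₃, e₄⟩ := hβ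
  refine ⟨by rw [s_t, t_t, e₁], by rw [s_t, t_t, e₂], ?_, ?_⟩
  · have := congrArg (InfGraph.t (Nat.lt_succ_self m)) e₃
    rw [M.t_comp_of_lt h, reflTo_succ h, M.t_refl] at this
    rw [this, t_t]
  · have := congrArg (InfGraph.t (Nat.lt_succ_self m)) e₄
    rw [M.t_comp_of_lt h, reflTo_succ h, M.t_refl] at this
    rw [this, s_t]

end Magma

/-! ### `(∞,n)`-magmas

Here and below `n` ranges over `ℕ∞ = ℕ ∪ {∞}`. For `n = ∞` no pair `(p, m)` satisfies
`n ≤ p < m`, so that there are no reversors and no invertibility conditions: for `n = ∞` one gets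
the `∞`-magmas, the strict `∞`-categories, and Penon's categorical stretchings. -/

/-- An `(∞,n)`-magma: an `∞`-magma whose `∞`-graph carries a specified `(∞,n)`-reversible
structure, i.e. reversors `j^m_p` for `n ≤ p < m`. -/
structure NMagma (n : ℕ∞) extends Magma.{u} where
  /-- the reversors `j^m_p` -/
  rev {p m : ℕ} (hn : n ≤ p) (h : p < m) (x : graph.Cell m) : graph.Cell m
  s_rev {p m : ℕ} (hn : n ≤ p) (h : p < m) (x : graph.Cell (m + 1)) :
    s (Nat.lt_succ_self m) (rev hn (h.trans (Nat.lt_succ_self m)) x) =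
      rev hn h (s (Nat.lt_succ_self m) x)
  t_rev {p m : ℕ} (hn : n ≤ p) (h : p < m) (x : graph.Cell (m + 1)) :
    t (Nat.lt_succ_self m) (rev hn (h.trans (Nat.lt_succ_self m)) x) =
      rev hn h (t (Nat.lt_succ_self m) x)
  s_rev_top {p : ℕ} (hn : n ≤ p) (x : graph.Cell (p + 1)) :
    s (Nat.lt_succ_self p) (rev hn (Nat.lt_succ_self p) x) = t (Nat.lt_succ_self p) x
  t_rev_top {p : ℕ} (hn : n ≤ p) (x : graph.Cell (p + 1)) :
    t (Nat.lt_succ_self p) (rev hn (Nat.lt_succ_self p) x) = s (Nat.lt_succ_self p) x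

/-- A morphism of `(∞,n)`-magmas: a morphism of `∞`-graphs preserving the reflexors, the
compositions and the reversors. -/
@[ext]
structure NMagma.Hom {n : ℕ∞} (M N : NMagma.{u} n) where
  /-- the underlying morphism of `∞`-graphs -/
  graphHom : M.graph ⟶ N.graph
  map_refl {m : ℕ} (x : M.graph.Cell m) : app graphHom (M.refl x) = N.refl (app graphHom x)
  map_comp {p m : ℕ} (h : p < m) (y x : M.graph.Cell m) (e : s h y = t h x) :
    app graphHom (M.comp h y x e) =
      N.comp h (app graphHom y) (app graphHom x) (by rw [app_s, app_t, e])
  map_rev {p m : ℕ} (hn : n ≤ p) (h : p < m) (x : M.graph.Cell m) :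
    app graphHom (M.rev hn h x) = N.rev hn h (app graphHom x)

/-- The category `(∞,n)-Mag`. -/
instance NMagma.category (n : ℕ∞) : Category (NMagma.{u} n) where
  Hom := NMagma.Hom
  id M :=
    { graphHom := 𝟙 _
      map_refl := fun _ => rfl
      map_comp := fun _ _ _ _ => rfl
      map_rev := fun _ _ _ => rfl }
  comp {M N K} f g :=
    { graphHom := f.graphHom ≫ g.graphHom
      map_refl := fun x => by
        change app g.graphHom (app f.graphHom _) = K.refl (app g.graphHom (app f.graphHom _))
        rw [f.map_refl, g.map_refl]
      map_comp := fun h y x e => by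
        have := congrArg (app g.graphHom) (f.map_comp h y x e)
        rw [g.map_comp] at this
        exact this
      map_rev := fun hn h x => by
        change app g.graphHom (app f.graphHom _) = K.rev _ _ (app g.graphHom (app f.graphHom _))
        rw [f.map_rev, g.map_rev] }

/-- Forgetting the reversors `j^m_p` with `n ≤ p < n'`. -/
def NMagma.restrict {n n' : ℕ∞} (hnn' : n ≤ n') (M : NMagma.{u} n) : NMagma.{u} n' where
  toMagma := M.toMagma
  rev hn h x := M.rev (hnn'.trans hn) h x
  s_rev hn h x := M.s_rev (hnn'.trans hn) h x
  t_rev hn h x := M.t_rev (hnn'.trans hn) h x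
  s_rev_top hn x := M.s_rev_top (hnn'.trans hn) x
  t_rev_top hn x := M.t_rev_top (hnn'.trans hn) x

/-! ### Strict `(∞,n)`-categories -/

/-- A strict `(∞,n)`-category: a strict `∞`-category in which every `m`-cell has a
`∘^m_p`-inverse whenever `n ≤ p < m`. -/
structure StrictCat (n : ℕ∞) extends Magma.{u} where
  isStrict : toMagma.IsStrict
  exists_inverse {p m : ℕ} (hn : n ≤ p) (h : p < m) (α : graph.Cell m) :
    ∃ β : graph.Cell m, Magma.IsInverse (M := toMagma) h α β

namespace StrictCat

variable {n n' : ℕ∞}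

/-- The canonical reversors of a strict `(∞,n)`-category: `j^m_p α` is the unique
`∘^m_p`-inverse of `α`. -/
noncomputable def inv (C : StrictCat.{u} n) {p m : ℕ} (hn : n ≤ p) (h : p < m)
    (α : C.graph.Cell m) : C.graph.Cell m :=
  Classical.choose (C.exists_inverse hn h α)

theorem isInverse_inv (C : StrictCat.{u} n) {p m : ℕ} (hn : n ≤ p) (h : p < m)
    (α : C.graph.Cell m) : Magma.IsInverse (M := C.toMagma) h α (C.inv hn h α) :=
  Classical.choose_spec (C.exists_inverse hn h α)

/-- The `(∞,n)`-magma underlying a strict `(∞,n)`-category. -/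
noncomputable def toNMagma (C : StrictCat.{u} n) : NMagma.{u} n where
  toMagma := C.toMagma
  rev hn h x := C.inv hn h x
  s_rev hn h x := (C.isInverse_inv hn _ x).s.unique C.isStrict (C.isInverse_inv hn h _)
  t_rev hn h x := (C.isInverse_inv hn _ x).t.unique C.isStrict (C.isInverse_inv hn h _)
  s_rev_top hn x := (C.isInverse_inv hn _ x).2.1
  t_rev_top hn x := (C.isInverse_inv hn _ x).1.symm

/-- A strict `(∞,n)`-category is a strict `(∞,n')`-category for `n ≤ n'`. -/
def restrict (hnn' : n ≤ n') (C : StrictCat.{u} n) : StrictCat.{u} n' where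
  toMagma := C.toMagma
  isStrict := C.isStrict
  exists_inverse hn h α := C.exists_inverse (hnn'.trans hn) h α

end StrictCat

/-! ### `(∞,n)`-categorical stretchings -/

/-- An `(∞,n)`-categorical stretching: an `(∞,n)`-magma `M`, a strict `(∞,n)`-category `C`, a
morphism `π : M ⟶ C` of `(∞,n)`-magmas, and a bracketing structure. -/
structure Stretching (n : ℕ∞) where
  /-- the `(∞,n)`-magma -/
  M : NMagma.{u} n
  /-- the strict `(∞,n)`-category -/
  C : StrictCat.{u} n
  /-- the projection -/
  π : M ⟶ C.toNMagma
  /-- the brackets `[c₁, c₀]_m` of parallel `m`-cells with the same projection -/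
  br {m : ℕ} (c₁ c₀ : M.graph.Cell m) (hp : Parallel c₁ c₀)
    (hπ : app π.graphHom c₁ = app π.graphHom c₀) : M.graph.Cell (m + 1)
  t_br {m : ℕ} (c₁ c₀ : M.graph.Cell m) (hp : Parallel c₁ c₀)
    (hπ : app π.graphHom c₁ = app π.graphHom c₀) : t (Nat.lt_succ_self m) (br c₁ c₀ hp hπ) = c₁
  s_br {m : ℕ} (c₁ c₀ : M.graph.Cell m) (hp : Parallel c₁ c₀)
    (hπ : app π.graphHom c₁ = app π.graphHom c₀) : s (Nat.lt_succ_self m) (br c₁ c₀ hp hπ) = c₀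
  π_br {m : ℕ} (c₁ c₀ : M.graph.Cell m) (hp : Parallel c₁ c₀)
    (hπ : app π.graphHom c₁ = app π.graphHom c₀) :
    app π.graphHom (br c₁ c₀ hp hπ) = C.refl (app π.graphHom c₁)
  br_self {m : ℕ} (c : M.graph.Cell m) (hp : Parallel c c) : br c c hp rfl = M.refl c

namespace Stretching

variable {n n' : ℕ∞}

theorem app_square {E E' : Stretching.{u} n} {f : E.M ⟶ E'.M}
    {g : E.C.toNMagma ⟶ E'.C.toNMagma} (w : f ≫ E'.π = E.π ≫ g) {m : ℕ}
    (x : E.M.graph.Cell m) :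
    app E'.π.graphHom (app f.graphHom x) = app g.graphHom (app E.π.graphHom x) :=
  congrArg (fun k : E.M ⟶ E'.C.toNMagma => app k.graphHom x) w

/-- A morphism of `(∞,n)`-categorical stretchings: a commutative square of morphisms of
`(∞,n)`-magmas whose upper morphism preserves the brackets. -/
@[ext]
structure Hom (E E' : Stretching.{u} n) where
  /-- the morphism between the `(∞,n)`-magmas -/
  mHom : E.M ⟶ E'.M
  /-- the morphism between the strict `(∞,n)`-categories -/
  cHom : E.C.toNMagma ⟶ E'.C.toNMagma
  w : mHom ≫ E'.π = E.π ≫ cHom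
  map_br {m : ℕ} (c₁ c₀ : E.M.graph.Cell m) (hp : Parallel c₁ c₀)
    (hπ : app E.π.graphHom c₁ = app E.π.graphHom c₀) :
    app mHom.graphHom (E.br c₁ c₀ hp hπ) =
      E'.br (app mHom.graphHom c₁) (app mHom.graphHom c₀) (hp.map mHom.graphHom)
        (by rw [app_square w, app_square w, hπ])

/-- The category `(∞,n)-EtCat`. -/
noncomputable instance category (n : ℕ∞) : Category (Stretching.{u} n) where
  Hom := Hom
  id E :=
    { mHom := 𝟙 _
      cHom := 𝟙 _
      w := (Category.id_comp _).trans (Category.comp_id _).symm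
      map_br := fun _ _ _ _ => rfl }
  comp {E E' E''} f g :=
    { mHom := f.mHom ≫ g.mHom
      cHom := f.cHom ≫ g.cHom
      w := by rw [Category.assoc, g.w, ← Category.assoc, f.w, Category.assoc]
      map_br := fun c₁ c₀ hp hπ => by
        have := congrArg (app g.mHom.graphHom) (f.map_br c₁ c₀ hp hπ)
        rw [g.map_br] at this
        exact this }

/-- The forgetful functor `U_n : (∞,n)-EtCat ⥤ ∞-Gr`, `(M, C, π, [-,-]) ↦ M`. -/
noncomputable def U (n : ℕ∞) : Stretching.{u} n ⥤ InfGraph.{u} where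
  obj E := E.M.graph
  map f := f.mHom.graphHom

/-- The functor `(∞,n)-EtCat ⥤ (∞,n')-EtCat`, `n ≤ n'`, that forgets the reversors `j^m_p` with
`n ≤ p < n'`. -/
noncomputable def forgetRev (hnn' : n ≤ n') : Stretching.{u} n ⥤ Stretching.{u} n' where
  obj E :=
    { M := E.M.restrict hnn'
      C := E.C.restrict hnn'
      π :=
        { graphHom := E.π.graphHom
          map_refl := E.π.map_refl
          map_comp := E.π.map_comp
          map_rev := fun hn h x => E.π.map_rev (hnn'.trans hn) h x }
      br := E.br
      t_br := E.t_br
      s_br := E.s_br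
      π_br := E.π_br
      br_self := E.br_self }
  map {E E'} f :=
    { mHom :=
        { graphHom := f.mHom.graphHom
          map_refl := f.mHom.map_refl
          map_comp := f.mHom.map_comp
          map_rev := fun hn h x => f.mHom.map_rev (hnn'.trans hn) h x }
      cHom :=
        { graphHom := f.cHom.graphHom
          map_refl := f.cHom.map_refl
          map_comp := f.cHom.map_comp
          map_rev := fun hn h x => f.cHom.map_rev (hnn'.trans hn) h x }
      w := by
        have h := congrArg NMagma.Hom.graphHom f.w
        exact NMagma.Hom.ext h
      map_br := f.map_br }

/-- `forgetRev` lies over `∞-Gr`. -/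
theorem forgetRev_comp_U (hnn' : n ≤ n') : forgetRev.{u} hnn' ⋙ U n' = U n := rfl

end Stretching

/-! ### The monads and the functors between their categories of algebras -/

section Monads

universe v₁ v₂ v₃ u₁ u₂ u₃

variable {B : Type u₁} [Category.{v₁} B] {D₁ : Type u₂} [Category.{v₂} D₁]
  {D₂ : Type u₃} [Category.{v₃} D₂] {F₁ : B ⥤ D₁} {U₁ : D₁ ⥤ B} {F₂ : B ⥤ D₂} {U₂ : D₂ ⥤ B}

/-- For adjunctions `F₁ ⊣ U₁`, `F₂ ⊣ U₂` and a functor `K` with `K ⋙ U₂ ≅ U₁`: the morphism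
`F₂ X ⟶ K (F₁ X)` which corresponds to the unit `X ⟶ U₁ (F₁ X) ≅ U₂ (K (F₁ X))`. -/
def compare (adj₁ : F₁ ⊣ U₁) (adj₂ : F₂ ⊣ U₂) (K : D₁ ⥤ D₂) (e : K ⋙ U₂ ≅ U₁) (X : B) :
    F₂.obj X ⟶ K.obj (F₁.obj X) :=
  (adj₂.homEquiv X (K.obj (F₁.obj X))).symm (adj₁.unit.app X ≫ e.inv.app (F₁.obj X))

theorem unit_compare (adj₁ : F₁ ⊣ U₁) (adj₂ : F₂ ⊣ U₂) (K : D₁ ⥤ D₂) (e : K ⋙ U₂ ≅ U₁) (X : B) :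
    adj₂.unit.app X ≫ U₂.map (compare adj₁ adj₂ K e X) =
      adj₁.unit.app X ≫ e.inv.app (F₁.obj X) := by
  have h := (adj₂.homEquiv X (K.obj (F₁.obj X))).apply_symm_apply
    (adj₁.unit.app X ≫ e.inv.app (F₁.obj X))
  rw [adj₂.homEquiv_unit] at h
  exact h

theorem compare_naturality (adj₁ : F₁ ⊣ U₁) (adj₂ : F₂ ⊣ U₂) (K : D₁ ⥤ D₂) (e : K ⋙ U₂ ≅ U₁)
    {X Y : B} (f : X ⟶ Y) :
    F₂.map f ≫ compare adj₁ adj₂ K e Y = compare adj₁ adj₂ K e X ≫ K.map (F₁.map f) := by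
  apply (adj₂.homEquiv X (K.obj (F₁.obj Y))).injective
  have h₁ : f ≫ adj₂.unit.app Y = adj₂.unit.app X ≫ U₂.map (F₂.map f) := adj₂.unit.naturality f
  have h₂ : f ≫ adj₁.unit.app Y = adj₁.unit.app X ≫ U₁.map (F₁.map f) := adj₁.unit.naturality f
  have h₃ : U₁.map (F₁.map f) ≫ e.inv.app (F₁.obj Y) =
    e.inv.app (F₁.obj X) ≫ U₂.map (K.map (F₁.map f)) := e.inv.naturality (F₁.map f)
  rw [adj₂.homEquiv_unit, adj₂.homEquiv_unit, U₂.map_comp, U₂.map_comp, ← reassoc_of% h₁,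
    unit_compare, reassoc_of% h₂, h₃, reassoc_of% (unit_compare adj₁ adj₂ K e X)]

theorem counit_compare (adj₁ : F₁ ⊣ U₁) (adj₂ : F₂ ⊣ U₂) (K : D₁ ⥤ D₂) (e : K ⋙ U₂ ≅ U₁)
    (X : B) :
    adj₂.counit.app (F₂.obj X) ≫ compare adj₁ adj₂ K e X =
      F₂.map (U₂.map (compare adj₁ adj₂ K e X) ≫ e.hom.app (F₁.obj X)) ≫
        compare adj₁ adj₂ K e (U₁.obj (F₁.obj X)) ≫ K.map (adj₁.counit.app (F₁.obj X)) := by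
  apply (adj₂.homEquiv (U₂.obj (F₂.obj X)) (K.obj (F₁.obj X))).injective
  have h₁ : (U₂.map (compare adj₁ adj₂ K e X) ≫ e.hom.app (F₁.obj X)) ≫
      adj₂.unit.app (U₁.obj (F₁.obj X)) = adj₂.unit.app (U₂.obj (F₂.obj X)) ≫
      U₂.map (F₂.map (U₂.map (compare adj₁ adj₂ K e X) ≫ e.hom.app (F₁.obj X))) :=
    adj₂.unit.naturality (U₂.map (compare adj₁ adj₂ K e X) ≫ e.hom.app (F₁.obj X))
  have h₂ : U₁.map (adj₁.counit.app (F₁.obj X)) ≫ e.inv.app (F₁.obj X) =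
      e.inv.app (F₁.obj (U₁.obj (F₁.obj X))) ≫ U₂.map (K.map (adj₁.counit.app (F₁.obj X))) :=
    e.inv.naturality (adj₁.counit.app (F₁.obj X))
  have h₃ : e.hom.app (F₁.obj X) ≫ e.inv.app (F₁.obj X) = 𝟙 (U₂.obj (K.obj (F₁.obj X))) :=
    e.hom_inv_id_app (F₁.obj X)
  rw [adj₂.homEquiv_unit, adj₂.homEquiv_unit, U₂.map_comp, U₂.map_comp, U₂.map_comp,
    adj₂.right_triangle_components_assoc, ← reassoc_of% h₁,
    reassoc_of% (unit_compare adj₁ adj₂ K e (U₁.obj (F₁.obj X))), ← h₂,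
    adj₁.right_triangle_components_assoc, h₃]
  exact (Category.comp_id _).symm

/-- The morphism of monads `U₂ F₂ ⟶ U₁ F₁` induced by a functor `K` over `B` from the domain of
`U₁` to that of `U₂`. -/
def monadHomOver (adj₁ : F₁ ⊣ U₁) (adj₂ : F₂ ⊣ U₂) (K : D₁ ⥤ D₂) (e : K ⋙ U₂ ≅ U₁) :
    adj₂.toMonad ⟶ adj₁.toMonad where
  app X := U₂.map (compare adj₁ adj₂ K e X) ≫ e.hom.app (F₁.obj X)
  naturality X Y f := by
    change U₂.map (F₂.map f) ≫ U₂.map (compare adj₁ adj₂ K e Y) ≫ e.hom.app (F₁.obj Y) =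
      (U₂.map (compare adj₁ adj₂ K e X) ≫ e.hom.app (F₁.obj X)) ≫ U₁.map (F₁.map f)
    have h : U₂.map (K.map (F₁.map f)) ≫ e.hom.app (F₁.obj Y) =
      e.hom.app (F₁.obj X) ≫ U₁.map (F₁.map f) := e.hom.naturality (F₁.map f)
    rw [← U₂.map_comp_assoc, compare_naturality, U₂.map_comp_assoc, h, Category.assoc]
  app_η X := by
    change adj₂.unit.app X ≫ U₂.map (compare adj₁ adj₂ K e X) ≫ e.hom.app (F₁.obj X) =
      adj₁.unit.app X
    have h : e.inv.app (F₁.obj X) ≫ e.hom.app (F₁.obj X) = 𝟙 (U₁.obj (F₁.obj X)) :=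
      e.inv_hom_id_app (F₁.obj X)
    rw [reassoc_of% (unit_compare adj₁ adj₂ K e X), h]
    exact Category.comp_id _
  app_μ X := by
    change U₂.map (adj₂.counit.app (F₂.obj X)) ≫ U₂.map (compare adj₁ adj₂ K e X) ≫
        e.hom.app (F₁.obj X) =
      (U₂.map (F₂.map (U₂.map (compare adj₁ adj₂ K e X) ≫ e.hom.app (F₁.obj X))) ≫
        U₂.map (compare adj₁ adj₂ K e (U₁.obj (F₁.obj X))) ≫
          e.hom.app (F₁.obj (U₁.obj (F₁.obj X)))) ≫ U₁.map (adj₁.counit.app (F₁.obj X))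
    have h : U₂.map (K.map (adj₁.counit.app (F₁.obj X))) ≫ e.hom.app (F₁.obj X) =
        e.hom.app (F₁.obj (U₁.obj (F₁.obj X))) ≫ U₁.map (adj₁.counit.app (F₁.obj X)) :=
      e.hom.naturality (adj₁.counit.app (F₁.obj X))
    rw [← U₂.map_comp_assoc, counit_compare, U₂.map_comp_assoc, U₂.map_comp_assoc, h]
    simp only [Category.assoc]

end Monads

/-- The monad `T^n` on `∞-Gr` generated by an adjunction `F_n ⊣ U_n`; for `n = ∞` this is Penon's
monad. -/
noncomputable abbrev T {n : ℕ∞} {F : InfGraph.{u} ⥤ Stretching.{u} n} (adj : F ⊣ Stretching.U n) :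
    Monad InfGraph.{u} :=
  adj.toMonad

/-- For `n ≤ n'`, the functor `Alg(T^n) ⥤ Alg(T^{n'})` that forgets the reversors `i^m_p` with
`n ≤ p < n'`: it is induced by the morphism of monads `T^{n'} ⟶ T^n` that comes from the functor
`(∞,n)-EtCat ⥤ (∞,n')-EtCat` over `∞-Gr`. -/
noncomputable def V {n n' : ℕ∞} (hnn' : n ≤ n') {F : InfGraph.{u} ⥤ Stretching.{u} n}
    {F' : InfGraph.{u} ⥤ Stretching.{u} n'} (adj : F ⊣ Stretching.U n)
    (adj' : F' ⊣ Stretching.U n') : (T adj).Algebra ⥤ (T adj').Algebra :=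
  Monad.algebraFunctorOfMonadHom
    (monadHomOver adj adj' (Stretching.forgetRev hnn') (Iso.refl _))

end WeakCat

namespace WeakCat

universe w

open InfGraph

/-! A functor has a left adjoint once each category of objects under a fixed object has an initial
object. Both halves of the theorem produce these initial objects by the same construction, a
hands-on form of the adjoint functor theorem. In the product of the whole, possibly large, family of
objects under the given one, take the values of all formal terms over the given object. The terms
form a small type and each has at most one value, so the values form a small structure. Its
projections are jointly monic, and they are natural because morphisms preserve the operations. By
`hasInitial_of_jointly_monic_cone` this structure is initial.

For `Stretching.U n` the operations are those of a stretching, and the construction is `joint`.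
Operations are partial, so a term has a value only if it makes sense in every member of the family.

For algebras, let `θ : T' ⟶ T` be a morphism of monads with `T` generated by an adjunction `F ⊣ U`,
and let `B i` run through the `T`-algebras under a `T'`-algebra `A`. Terms are evaluated in the free
stretchings `F (B i)`, with one more unary operation "structure map, then unit". The images of the
values under the structure maps form a small subgraph `S` of the product of the `B i`. By
`free_induction`, every cell of `T S` is built from units by stretching operations. Hence its image
in each `T (B i)` is given by one common term (`map_proj_mem`), and `S` is a subalgebra. No
exactness or rank condition on the monads is used. -/

/-- A jointly monic cone over the identity functor has an initial vertex. -/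
theorem hasInitial_of_jointly_monic_cone {D : Type*} [Category D] (L : D) (p : ∀ i : D, L ⟶ i)
    (natural : ∀ {i j : D} (h : i ⟶ j), p i ≫ h = p j)
    (monic : ∀ f : L ⟶ L, (∀ i, f ≫ p i = p i) → f = 𝟙 L) : Limits.HasInitial D := by
  -- Naturality along `p i : L ⟶ i` itself says `p L ≫ p i = p i`.
  have hL : p L = 𝟙 L := monic _ fun i => natural (p i)
  refine Limits.IsInitial.hasInitial (X := L) (Limits.IsInitial.ofUniqueHom p fun i g => ?_)
  rw [← natural g, hL, Category.id_comp]

/-! ### Cellwise calculus of `∞`-graphs, and small subgraphs of large products -/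

namespace InfGraph

variable {X Y Z : InfGraph.{u}}

/-- The action on cells of a morphism of the globe category. -/
def face (X : InfGraph.{u}) {p m : ℕ} (g : Globe.mk p ⟶ Globe.mk m) (x : X.Cell m) : X.Cell p :=
  X.map g.op x

theorem app_face (f : X ⟶ Y) {p m : ℕ} (g : Globe.mk p ⟶ Globe.mk m) (x : X.Cell m) :
    app f (X.face g x) = Y.face g (app f x) :=
  NatTrans.naturality_apply f g.op x

theorem app_comp (f : X ⟶ Y) (g : Y ⟶ Z) {m : ℕ} (x : X.Cell m) :
    app (f ≫ g) x = app g (app f x) :=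
  rfl

theorem hom_ext {f g : X ⟶ Y} (h : ∀ {m : ℕ} (x : X.Cell m), app f x = app g x) : f = g := by
  apply NatTrans.ext
  funext a
  ext x
  exact h (m := a.unop.dim) x

/-- A morphism of `∞`-graphs from maps on cells. -/
def homMk (f : ∀ m, X.Cell m → Y.Cell m)
    (hf : ∀ {p m : ℕ} (g : Globe.mk p ⟶ Globe.mk m) (x : X.Cell m),
      f p (X.face g x) = Y.face g (f m x)) : X ⟶ Y where
  app a := TypeCat.ofHom (f a.unop.dim)
  naturality a b g := by
    ext x
    exact hf (p := b.unop.dim) (m := a.unop.dim) g.unop x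

end InfGraph

/-- A small sub-`∞`-graph of the product of a possibly large family of `∞`-graphs. -/
structure JointSub {I : Type w} (Y : I → InfGraph.{u}) where
  /-- the cells -/
  carrier (m : ℕ) : Set (∀ i, (Y i).Cell m)
  small (m : ℕ) : Small.{u} (carrier m)
  face_mem {p m : ℕ} (g : Globe.mk p ⟶ Globe.mk m) {a : ∀ i, (Y i).Cell m} (ha : a ∈ carrier m) :
    (fun i => (Y i).face g (a i)) ∈ carrier p

namespace JointSub

variable {I : Type w} {Y : I → InfGraph.{u}} (S : JointSub Y)

attribute [instance] JointSub.small

/-- The `∞`-graph underlying a small sub-`∞`-graph of a product. -/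
noncomputable def graph : InfGraph.{u} where
  obj a := Shrink.{u} (S.carrier a.unop.dim)
  map {a b} g := TypeCat.ofHom fun x =>
    equivShrink (S.carrier b.unop.dim)
      ⟨_, S.face_mem (p := b.unop.dim) (m := a.unop.dim) g.unop ((equivShrink _).symm x).2⟩
  map_id a := by
    ext x i
    simp [InfGraph.face]
    rfl
  map_comp {a b c} g h := by
    ext x i
    simp [InfGraph.face]
    rfl

/-- The cell with given components. -/
noncomputable def cell {m : ℕ} (a : ∀ i, (Y i).Cell m) (ha : a ∈ S.carrier m) : S.graph.Cell m :=
  equivShrink (S.carrier m) ⟨a, ha⟩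

/-- The projections. -/
noncomputable def proj (i : I) : S.graph ⟶ Y i :=
  homMk (fun m x => ((equivShrink (S.carrier m)).symm x).1 i) fun g x => by
    exact congrArg (fun z : S.carrier _ => z.1 i) ((equivShrink (S.carrier _)).symm_apply_apply _)

theorem app_proj_cell {m : ℕ} (a : ∀ i, (Y i).Cell m) (ha : a ∈ S.carrier m) (i : I) :
    app (S.proj i) (S.cell a ha) = a i :=
  congrArg (fun z : S.carrier m => z.1 i) ((equivShrink (S.carrier m)).symm_apply_apply ⟨a, ha⟩)

theorem mem {m : ℕ} (x : S.graph.Cell m) : (fun i => app (S.proj i) x) ∈ S.carrier m :=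
  ((equivShrink (S.carrier m)).symm x).2

variable {S}

theorem ext {m : ℕ} {x y : S.graph.Cell m} (h : ∀ i, app (S.proj i) x = app (S.proj i) y) :
    x = y :=
  (equivShrink (S.carrier m)).symm.injective (Subtype.ext (funext h))

theorem hom_ext {X : InfGraph.{u}} {f g : X ⟶ S.graph} (h : ∀ i, f ≫ S.proj i = g ≫ S.proj i) :
    f = g :=
  InfGraph.hom_ext fun x => ext fun i => by rw [← app_comp, h, app_comp]

/-- Morphisms into a small sub-`∞`-graph of a product. -/
noncomputable def lift {X : InfGraph.{u}} (f : ∀ i, X ⟶ Y i)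
    (hf : ∀ {m : ℕ} (x : X.Cell m), (fun i => app (f i) x) ∈ S.carrier m) : X ⟶ S.graph :=
  homMk (fun _ x => S.cell _ (hf x)) fun g x => ext fun i => by
    rw [app_face, app_proj_cell, app_proj_cell, app_face]

theorem lift_proj {X : InfGraph.{u}} (f : ∀ i, X ⟶ Y i)
    (hf : ∀ {m : ℕ} (x : X.Cell m), (fun i => app (f i) x) ∈ S.carrier m) (i : I) :
    lift f hf ≫ S.proj i = f i :=
  InfGraph.hom_ext fun x => S.app_proj_cell _ (hf x) i

end JointSub

/-! ### Formal terms and their partial evaluation -/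

/-- Formal terms over the cells of an `∞`-graph in the operations of an `(∞,n)`-categorical
stretching and one additional unary operation. -/
inductive Tm (X : InfGraph.{u}) : ℕ → Type u
  | gen {m : ℕ} (x : X.Cell m) : Tm X m
  -- The additional operation is interpreted by the maps `φ i` below: by identities for stretchings,
  -- by "structure map, then unit" for algebras.
  | act {m : ℕ} (v : Tm X m) : Tm X m
  | face {p m : ℕ} (g : Globe.mk p ⟶ Globe.mk m) (v : Tm X m) : Tm X p
  | refl {m : ℕ} (v : Tm X m) : Tm X (m + 1)
  | comp {p m : ℕ} (h : p < m) (v v' : Tm X m) : Tm X m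
  | rev {p m : ℕ} (h : p < m) (v : Tm X m) : Tm X m
  | br {m : ℕ} (v v' : Tm X m) : Tm X (m + 1)

/-- Formal terms over `Tm X` in the operations of a strict `(∞,n)`-category. -/
inductive CTm (X : InfGraph.{u}) : ℕ → Type u
  -- The values of these terms alone would not suffice: `π y` and `π x` can be composable when `y`
  -- and `x` are not, so the image of `π` need not be closed under composition.
  | pi {m : ℕ} (v : Tm X m) : CTm X m
  | face {p m : ℕ} (g : Globe.mk p ⟶ Globe.mk m) (v : CTm X m) : CTm X p
  | refl {m : ℕ} (v : CTm X m) : CTm X (m + 1)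
  | comp {p m : ℕ} (h : p < m) (v v' : CTm X m) : CTm X m
  | inv {p m : ℕ} (h : p < m) (v : CTm X m) : CTm X m

section Eval

variable {n : ℕ∞} {I : Type w} {X : InfGraph.{u}} (E : I → Stretching.{u} n)
  (f : ∀ i, X ⟶ (E i).M.graph) (φ : ∀ i, (E i).M.graph ⟶ (E i).M.graph)

/-- The value of a term in a family of stretchings; this set is empty if the term is not
meaningful in all members of the family. -/
def Tm.eval : {m : ℕ} → Tm X m → Set (∀ i, (E i).M.graph.Cell m)
  | _, .gen x => {fun i => app (f i) x}
  | _, .act v => {z | ∃ a ∈ v.eval, z = fun i => app (φ i) (a i)}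
  | _, .face g v => {z | ∃ a ∈ v.eval, z = fun i => (E i).M.graph.face g (a i)}
  | _, .refl v => {z | ∃ a ∈ v.eval, z = fun i => (E i).M.refl (a i)}
  | _, .comp h v v' => {z | ∃ a ∈ v.eval, ∃ b ∈ v'.eval, ∃ e : ∀ i, s h (a i) = t h (b i),
      z = fun i => (E i).M.comp h (a i) (b i) (e i)}
  | _, .rev (p := p) h v => {z | ∃ a ∈ v.eval, ∃ hn : n ≤ p, z = fun i => (E i).M.rev hn h (a i)}
  | _, .br v v' => {z | ∃ a ∈ v.eval, ∃ b ∈ v'.eval, ∃ (hp : ∀ i, Parallel (a i) (b i))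
      (hπ : ∀ i, app (E i).π.graphHom (a i) = app (E i).π.graphHom (b i)),
      z = fun i => (E i).br (a i) (b i) (hp i) (hπ i)}

/-- The side conditions are propositions, so the values of the subterms determine the value of the
term. This is the source of smallness: distinct values need distinct terms. -/
theorem Tm.eval_subsingleton {m : ℕ} (v : Tm X m) : (v.eval E f φ).Subsingleton := by
  induction v with
  | gen x => exact Set.subsingleton_singleton
  | act v ih | face g v ih | refl v ih =>
    rintro _ ⟨a, ha, rfl⟩ _ ⟨a', ha', rfl⟩
    cases ih ha ha'
    rfl
  | comp h v v' ih ih' =>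
    rintro _ ⟨a, ha, b, hb, e, rfl⟩ _ ⟨a', ha', b', hb', e', rfl⟩
    cases ih ha ha'
    cases ih' hb hb'
    rfl
  | rev h v ih =>
    rintro _ ⟨a, ha, e, rfl⟩ _ ⟨a', ha', e', rfl⟩
    cases ih ha ha'
    rfl
  | br v v' ih ih' =>
    rintro _ ⟨a, ha, b, hb, e, d, rfl⟩ _ ⟨a', ha', b', hb', e', d', rfl⟩
    cases ih ha ha'
    cases ih' hb hb'
    rfl

/-- The value of a term in a family of strict `(∞,n)`-categories. -/
def CTm.eval : {m : ℕ} → CTm X m → Set (∀ i, (E i).C.graph.Cell m)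
  | _, .pi v => {z | ∃ a ∈ v.eval E f φ, z = fun i => app (E i).π.graphHom (a i)}
  | _, .face g v => {z | ∃ a ∈ v.eval, z = fun i => (E i).C.graph.face g (a i)}
  | _, .refl v => {z | ∃ a ∈ v.eval, z = fun i => (E i).C.refl (a i)}
  | _, .comp h v v' => {z | ∃ a ∈ v.eval, ∃ b ∈ v'.eval, ∃ e : ∀ i, s h (a i) = t h (b i),
      z = fun i => (E i).C.comp h (a i) (b i) (e i)}
  | _, .inv (p := p) h v => {z | ∃ a ∈ v.eval, ∃ hn : n ≤ p, z = fun i => (E i).C.inv hn h (a i)}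

theorem CTm.eval_subsingleton {m : ℕ} (v : CTm X m) : (v.eval E f φ).Subsingleton := by
  induction v with
  | pi v =>
    rintro _ ⟨a, ha, rfl⟩ _ ⟨a', ha', rfl⟩
    cases v.eval_subsingleton E f φ ha ha'
    rfl
  | face g v ih | refl v ih =>
    rintro _ ⟨a, ha, rfl⟩ _ ⟨a', ha', rfl⟩
    cases ih ha ha'
    rfl
  | comp h v v' ih ih' =>
    rintro _ ⟨a, ha, b, hb, e, rfl⟩ _ ⟨a', ha', b', hb', e', rfl⟩
    cases ih ha ha'
    cases ih' hb hb'
    rfl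
  | inv h v ih =>
    rintro _ ⟨a, ha, e, rfl⟩ _ ⟨a', ha', e', rfl⟩
    cases ih ha ha'
    rfl

/-- Choosing for each value a term that has it is an injection into `T`. -/
theorem small_iUnion_of_subsingleton {α : Type w} {T : Type u} (e : T → Set α)
    (he : ∀ v, (e v).Subsingleton) : Small.{u} {a | ∃ v, a ∈ e v} := by
  choose v hv using fun a : {a | ∃ v, a ∈ e v} => a.2
  refine small_of_injective (f := v) fun a b h => Subtype.ext (he (v a) (hv a) ?_)
  rw [h]
  exact hv b

/-- The values of all terms in the upper magmas of a family of stretchings. -/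
def jointM : JointSub fun i => (E i).M.graph where
  carrier m := {a | ∃ v : Tm X m, a ∈ v.eval E f φ}
  small _ := small_iUnion_of_subsingleton _ fun v => v.eval_subsingleton E f φ
  face_mem := fun g _ ⟨v, hv⟩ => ⟨.face g v, _, hv, rfl⟩

/-- The values of all terms in the strict `(∞,n)`-categories of a family of stretchings. -/
def jointC : JointSub fun i => (E i).C.graph where
  carrier m := {a | ∃ v : CTm X m, a ∈ v.eval E f φ}
  small _ := small_iUnion_of_subsingleton _ fun v => v.eval_subsingleton E f φ
  face_mem := fun g _ ⟨v, hv⟩ => ⟨.face g v, _, hv, rfl⟩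

end Eval

/-! ### Maps preserving reflexors and compositions preserve inverses -/

namespace Magma

variable {M N : Magma.{u}}

theorem app_reflTo (k : M.graph ⟶ N.graph)
    (hk : ∀ {m : ℕ} (x : M.graph.Cell m), app k (M.refl x) = N.refl (app k x)) {p m : ℕ}
    (h : p < m) (x : M.graph.Cell p) : app k (reflTo h x) = reflTo h (app k x) := by
  induction m, h using Nat.le_induction with
  | base => rw [reflTo_self, reflTo_self, hk]
  | succ m h ih => rw [reflTo_succ h, reflTo_succ h, hk, ih]

theorem reflTo_congr {p m : ℕ} (h : p < m) {x y : M.graph.Cell p} (e : x = y) :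
    reflTo (M := M) h x = reflTo h y :=
  congrArg _ e

/-- Reversors are deliberately absent from the hypotheses: the lemma serves to deduce their
preservation from uniqueness of inverses. -/
theorem IsInverse.map (k : M.graph ⟶ N.graph)
    (hk : ∀ {m : ℕ} (x : M.graph.Cell m), app k (M.refl x) = N.refl (app k x))
    (hk' : ∀ {p m : ℕ} (h : p < m) (y x : M.graph.Cell m) (e : InfGraph.s h y = InfGraph.t h x),
      app k (M.comp h y x e) = N.comp h (app k y) (app k x) (by rw [app_s, app_t, e]))
    {p m : ℕ} {h : p < m} {α β : M.graph.Cell m} (H : IsInverse h α β) :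
    IsInverse h (app k α) (app k β) := by
  obtain ⟨e, e', H, H'⟩ := H
  refine ⟨by rw [app_s, app_t, e], by rw [app_s, app_t, e'], ?_, ?_⟩
  · rw [← hk' h _ _ e, H, app_reflTo k hk, app_t]
  · rw [← hk' h _ _ e', H', app_reflTo k hk, app_s]

end Magma

/-- Between strict `(∞,n)`-categories the reversors are preserved automatically. -/
theorem StrictCat.app_inv {n : ℕ∞} {C D : StrictCat.{u} n} (k : C.graph ⟶ D.graph)
    (hk : ∀ {m : ℕ} (x : C.graph.Cell m), app k (C.refl x) = D.refl (app k x))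
    (hk' : ∀ {p m : ℕ} (h : p < m) (y x : C.graph.Cell m) (e : s h y = t h x),
      app k (C.comp h y x e) = D.comp h (app k y) (app k x) (by rw [app_s, app_t, e]))
    {p m : ℕ} (hn : n ≤ p) (h : p < m) (x : C.graph.Cell m) :
    app k (C.inv hn h x) = D.inv hn h (app k x) :=
  ((C.isInverse_inv hn h x).map k hk hk').unique D.isStrict (D.isInverse_inv hn h _)

/-! ### The stretching of term values in a family of stretchings -/

section Joint

variable {n : ℕ∞} {I : Type w} {X : InfGraph.{u}} (E : I → Stretching.{u} n)
  (f : ∀ i, X ⟶ (E i).M.graph) (φ : ∀ i, (E i).M.graph ⟶ (E i).M.graph)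

/-- The `(∞,n)`-magma of values of terms in a family of stretchings. -/
noncomputable abbrev jointMagma : NMagma.{u} n where
  graph := (jointM E f φ).graph
  refl {m} x := (jointM E f φ).cell (fun i => (E i).M.refl (app ((jointM E f φ).proj i) x)) <| by
    obtain ⟨v, hv⟩ := (jointM E f φ).mem x
    exact ⟨.refl v, _, hv, rfl⟩
  s_refl x := JointSub.ext fun i => by
    rw [← app_s, JointSub.app_proj_cell, (E i).M.s_refl]
  t_refl x := JointSub.ext fun i => by
    rw [← app_t, JointSub.app_proj_cell, (E i).M.t_refl]
  comp h y x e := (jointM E f φ).cell (fun i => (E i).M.comp h (app ((jointM E f φ).proj i) y)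
      (app ((jointM E f φ).proj i) x) (by rw [app_s, app_t, e])) <| by
    obtain ⟨v, hv⟩ := (jointM E f φ).mem y
    obtain ⟨w, hw⟩ := (jointM E f φ).mem x
    exact ⟨.comp h v w, _, hv, _, hw, _, rfl⟩
  s_comp h y x e := JointSub.ext fun i => by
    rw [← app_s, JointSub.app_proj_cell, (E i).M.s_comp, app_s]
  t_comp h y x e := JointSub.ext fun i => by
    rw [← app_t, JointSub.app_proj_cell, (E i).M.t_comp, app_t]
  s_comp_of_lt h h' y x e := JointSub.ext fun i => by
    rw [← app_s, JointSub.app_proj_cell, JointSub.app_proj_cell, (E i).M.s_comp_of_lt]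
    exact Magma.comp_congr h (app_s _ _ _) (app_s _ _ _) _
  t_comp_of_lt h h' y x e := JointSub.ext fun i => by
    rw [← app_t, JointSub.app_proj_cell, JointSub.app_proj_cell, (E i).M.t_comp_of_lt]
    exact Magma.comp_congr h (app_t _ _ _) (app_t _ _ _) _
  rev hn h x := (jointM E f φ).cell
      (fun i => (E i).M.rev hn h (app ((jointM E f φ).proj i) x)) <| by
    obtain ⟨v, hv⟩ := (jointM E f φ).mem x
    exact ⟨.rev h v, _, hv, hn, rfl⟩
  s_rev hn h x := JointSub.ext fun i => by
    rw [← app_s, JointSub.app_proj_cell, JointSub.app_proj_cell, (E i).M.s_rev, app_s]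
  t_rev hn h x := JointSub.ext fun i => by
    rw [← app_t, JointSub.app_proj_cell, JointSub.app_proj_cell, (E i).M.t_rev, app_t]
  s_rev_top hn x := JointSub.ext fun i => by
    rw [← app_s, JointSub.app_proj_cell, (E i).M.s_rev_top, app_t]
  t_rev_top hn x := JointSub.ext fun i => by
    rw [← app_t, JointSub.app_proj_cell, (E i).M.t_rev_top, app_s]

/-- The projections of `jointMagma`. -/
noncomputable def jointMagmaProj (i : I) : jointMagma E f φ ⟶ (E i).M where
  graphHom := (jointM E f φ).proj i
  map_refl _ := JointSub.app_proj_cell _ _ _ i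
  map_comp _ _ _ _ := JointSub.app_proj_cell _ _ _ i
  map_rev _ _ _ := JointSub.app_proj_cell _ _ _ i

/-- The `∞`-magma of values of terms in a family of strict `(∞,n)`-categories. -/
noncomputable abbrev jointCMagma : Magma.{u} where
  graph := (jointC E f φ).graph
  refl {m} x := (jointC E f φ).cell (fun i => (E i).C.refl (app ((jointC E f φ).proj i) x)) <| by
    obtain ⟨v, hv⟩ := (jointC E f φ).mem x
    exact ⟨.refl v, _, hv, rfl⟩
  s_refl x := JointSub.ext fun i => by
    rw [← app_s, JointSub.app_proj_cell, (E i).C.s_refl]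
  t_refl x := JointSub.ext fun i => by
    rw [← app_t, JointSub.app_proj_cell, (E i).C.t_refl]
  comp h y x e := (jointC E f φ).cell (fun i => (E i).C.comp h (app ((jointC E f φ).proj i) y)
      (app ((jointC E f φ).proj i) x) (by rw [app_s, app_t, e])) <| by
    obtain ⟨v, hv⟩ := (jointC E f φ).mem y
    obtain ⟨w, hw⟩ := (jointC E f φ).mem x
    exact ⟨.comp h v w, _, hv, _, hw, _, rfl⟩
  s_comp h y x e := JointSub.ext fun i => by
    rw [← app_s, JointSub.app_proj_cell, (E i).C.s_comp, app_s]
  t_comp h y x e := JointSub.ext fun i => by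
    rw [← app_t, JointSub.app_proj_cell, (E i).C.t_comp, app_t]
  s_comp_of_lt h h' y x e := JointSub.ext fun i => by
    rw [← app_s, JointSub.app_proj_cell, JointSub.app_proj_cell, (E i).C.s_comp_of_lt]
    exact Magma.comp_congr h (app_s _ _ _) (app_s _ _ _) _
  t_comp_of_lt h h' y x e := JointSub.ext fun i => by
    rw [← app_t, JointSub.app_proj_cell, JointSub.app_proj_cell, (E i).C.t_comp_of_lt]
    exact Magma.comp_congr h (app_t _ _ _) (app_t _ _ _) _

theorem jointCMagma_refl (i : I) {m : ℕ} (x : (jointCMagma E f φ).graph.Cell m) :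
    app ((jointC E f φ).proj i) ((jointCMagma E f φ).refl x) =
      (E i).C.refl (app ((jointC E f φ).proj i) x) :=
  JointSub.app_proj_cell _ _ _ i

theorem jointCMagma_comp (i : I) {p m : ℕ} (h : p < m) (y x : (jointCMagma E f φ).graph.Cell m)
    (e : s h y = t h x) :
    app ((jointC E f φ).proj i) ((jointCMagma E f φ).comp h y x e) =
      (E i).C.comp h (app ((jointC E f φ).proj i) y) (app ((jointC E f φ).proj i) x)
        (by rw [app_s, app_t]; exact congrArg _ e) :=
  JointSub.app_proj_cell _ _ _ i

theorem jointCMagma_reflTo (i : I) {p m : ℕ} (h : p < m)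
    (x : (jointCMagma E f φ).graph.Cell p) :
    app ((jointC E f φ).proj i) (Magma.reflTo h x) =
      Magma.reflTo (M := (E i).C.toMagma) h (app ((jointC E f φ).proj i) x) :=
  Magma.app_reflTo (M := jointCMagma E f φ) (N := (E i).C.toMagma) ((jointC E f φ).proj i)
    (jointCMagma_refl E f φ i) h x

/-- The axioms are equations between cells, and the projections are jointly injective, so each axiom
is inherited from the components. Arguments of a composition are exchanged through
`Magma.comp_congr`, since the composability proof depends on them. -/
theorem jointCMagma_isStrict : (jointCMagma E f φ).IsStrict where
  comp_assoc h z y x e e' := JointSub.ext fun i => by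
    refine (jointCMagma_comp E f φ i h _ _ _).trans ?_
    refine (Magma.comp_congr h (jointCMagma_comp E f φ i h z y e) rfl _).trans ?_
    refine Eq.trans ?_ (jointCMagma_comp E f φ i h _ _ _).symm
    refine ((E i).C.isStrict.comp_assoc h _ _ _ _ ?_).trans
      (Magma.comp_congr h rfl (jointCMagma_comp E f φ i h y x e').symm _)
    rw [app_s, app_t]
    exact congrArg _ e'
  refl_comp h x := JointSub.ext fun i => by
    rw [jointCMagma_comp]
    refine (Magma.comp_congr h ((jointCMagma_reflTo E f φ i h _).trans
      (Magma.reflTo_congr h (app_t _ _ _).symm)) rfl _).trans ?_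
    exact (E i).C.isStrict.refl_comp h _
  comp_refl h x := JointSub.ext fun i => by
    rw [jointCMagma_comp]
    refine (Magma.comp_congr h rfl ((jointCMagma_reflTo E f φ i h _).trans
      (Magma.reflTo_congr h (app_s _ _ _).symm)) _).trans ?_
    exact (E i).C.isStrict.comp_refl h _
  interchange h h' y' y x' x e₁ e₂ e₃ e₄ := JointSub.ext fun i => by
    refine (jointCMagma_comp E f φ i _ _ _ _).trans ?_
    refine (Magma.comp_congr _ (jointCMagma_comp E f φ i h' y' y e₁)
      (jointCMagma_comp E f φ i h' x' x e₂) _).trans ?_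
    refine Eq.trans ?_ (jointCMagma_comp E f φ i _ _ _ _).symm
    refine ((E i).C.isStrict.interchange h h' _ _ _ _ _ _ ?_ ?_).trans
      (Magma.comp_congr _ (jointCMagma_comp E f φ i _ y' x' e₃).symm
        (jointCMagma_comp E f φ i _ y x e₄).symm _)
    · rw [app_s, app_t]
      exact congrArg _ e₃
    · rw [app_s, app_t]
      exact congrArg _ e₄
  refl_of_comp h y x e := JointSub.ext fun i => by
    rw [jointCMagma_comp, jointCMagma_refl]
    refine (congrArg (E i).C.refl (jointCMagma_comp E f φ i h y x e)).trans ?_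
    exact ((E i).C.isStrict.refl_of_comp h _ _ _).trans
      (Magma.comp_congr _ (jointCMagma_refl E f φ i y).symm (jointCMagma_refl E f φ i x).symm _)

/-- The strict `(∞,n)`-category of values of terms in a family of strict `(∞,n)`-categories. -/
noncomputable abbrev jointStrictCat : StrictCat.{u} n where
  toMagma := jointCMagma E f φ
  isStrict := jointCMagma_isStrict E f φ
  exists_inverse {p m} hn h α := by
    have H (i : I) := (E i).C.isInverse_inv hn h (app ((jointC E f φ).proj i) α)
    -- The tuple of componentwise inverses is again a term value, thanks to the constructor
    -- `CTm.inv`.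
    let β : (jointCMagma E f φ).graph.Cell m := (jointC E f φ).cell
      (fun i => (E i).C.inv hn h (app ((jointC E f φ).proj i) α)) (by
        obtain ⟨v, hv⟩ := (jointC E f φ).mem α
        exact ⟨.inv h v, _, hv, hn, rfl⟩)
    have hβ (i : I) : app ((jointC E f φ).proj i) β =
        (E i).C.inv hn h (app ((jointC E f φ).proj i) α) := JointSub.app_proj_cell _ _ _ i
    refine ⟨β, JointSub.ext fun i => ?_, JointSub.ext fun i => ?_, JointSub.ext fun i => ?_,
      JointSub.ext fun i => ?_⟩
    · rw [← app_s, ← app_t, hβ]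
      exact (H i).1
    · rw [← app_s, ← app_t, hβ]
      exact (H i).2.1
    · rw [jointCMagma_comp, jointCMagma_reflTo]
      refine (Magma.comp_congr h rfl (hβ i) _).trans ((H i).2.2.1.trans ?_)
      exact Magma.reflTo_congr h (app_t _ _ _)
    · rw [jointCMagma_comp, jointCMagma_reflTo]
      refine (Magma.comp_congr h (hβ i) rfl _).trans ((H i).2.2.2.trans ?_)
      exact Magma.reflTo_congr h (app_s _ _ _)

/-- The projections of `jointStrictCat`. -/
noncomputable def jointStrictCatProj (i : I) :
    (jointStrictCat E f φ).toNMagma ⟶ (E i).C.toNMagma where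
  graphHom := (jointC E f φ).proj i
  map_refl := jointCMagma_refl E f φ i
  map_comp := jointCMagma_comp E f φ i
  -- `StrictCat.inv` is chosen independently in the joint category and in each component; uniqueness
  -- of inverses makes the choices agree.
  map_rev := StrictCat.app_inv (C := jointStrictCat E f φ) (D := (E i).C) _
    (jointCMagma_refl E f φ i) (jointCMagma_comp E f φ i)

/-- The projection from `jointMagma` to `jointStrictCat`, on `∞`-graphs. -/
noncomputable def jointπGraph : (jointM E f φ).graph ⟶ (jointC E f φ).graph :=
  JointSub.lift (fun i => (jointM E f φ).proj i ≫ (E i).π.graphHom) fun x => by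
    obtain ⟨v, hv⟩ := (jointM E f φ).mem x
    exact ⟨.pi v, _, hv, rfl⟩

theorem proj_jointπGraph (i : I) {m : ℕ} (x : (jointM E f φ).graph.Cell m) :
    app ((jointC E f φ).proj i) (app (jointπGraph E f φ) x) =
      app (E i).π.graphHom (app ((jointM E f φ).proj i) x) :=
  JointSub.app_proj_cell _ _ _ i

/-- The projection from `jointMagma` to `jointStrictCat`. -/
noncomputable def jointπ : jointMagma E f φ ⟶ (jointStrictCat E f φ).toNMagma where
  graphHom := jointπGraph E f φ
  map_refl x := JointSub.ext (S := jointC E f φ) fun i => by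
    refine (proj_jointπGraph E f φ i _).trans ?_
    refine (congrArg (app (E i).π.graphHom) ((jointMagmaProj E f φ i).map_refl x)).trans ?_
    refine ((E i).π.map_refl _).trans ?_
    refine Eq.trans ?_ (jointCMagma_refl E f φ i _).symm
    exact congrArg (E i).C.refl (proj_jointπGraph E f φ i x).symm
  map_comp h y x e := JointSub.ext (S := jointC E f φ) fun i => by
    refine (proj_jointπGraph E f φ i _).trans ?_
    refine (congrArg (app (E i).π.graphHom) ((jointMagmaProj E f φ i).map_comp h y x e)).trans ?_
    refine ((E i).π.map_comp h _ _ _).trans ?_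
    refine Eq.trans ?_ (jointCMagma_comp E f φ i h _ _ _).symm
    exact Magma.comp_congr (M := (E i).C.toMagma) h (proj_jointπGraph E f φ i y).symm
      (proj_jointπGraph E f φ i x).symm _
  map_rev hn h x := JointSub.ext (S := jointC E f φ) fun i => by
    refine (proj_jointπGraph E f φ i _).trans ?_
    refine (congrArg (app (E i).π.graphHom) ((jointMagmaProj E f φ i).map_rev hn h x)).trans ?_
    refine ((E i).π.map_rev hn h _).trans ?_
    refine Eq.trans ?_ ((jointStrictCatProj E f φ i).map_rev hn h _).symm
    exact congrArg ((E i).C.inv hn h) (proj_jointπGraph E f φ i x).symm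

/-- The stretching of values of terms in a family of stretchings. -/
noncomputable def joint : Stretching.{u} n where
  M := jointMagma E f φ
  C := jointStrictCat E f φ
  π := jointπ E f φ
  br c₁ c₀ hp hπ := (jointM E f φ).cell (fun i => (E i).br (app ((jointM E f φ).proj i) c₁)
      (app ((jointM E f φ).proj i) c₀) (hp.map _)
      ((proj_jointπGraph E f φ i c₁).symm.trans
        ((congrArg (app ((jointC E f φ).proj i)) hπ).trans (proj_jointπGraph E f φ i c₀)))) <| by
    obtain ⟨v, hv⟩ := (jointM E f φ).mem c₁
    obtain ⟨w, hw⟩ := (jointM E f φ).mem c₀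
    exact ⟨.br v w, _, hv, _, hw, _, _, rfl⟩
  t_br c₁ c₀ hp hπ := JointSub.ext fun i => by
    rw [← app_t, JointSub.app_proj_cell]
    exact (E i).t_br _ _ _ _
  s_br c₁ c₀ hp hπ := JointSub.ext fun i => by
    rw [← app_s, JointSub.app_proj_cell]
    exact (E i).s_br _ _ _ _
  π_br c₁ c₀ hp hπ := JointSub.ext (S := jointC E f φ) fun i => by
    refine (proj_jointπGraph E f φ i _).trans ?_
    refine (congrArg (app (E i).π.graphHom) (JointSub.app_proj_cell _ _ _ i)).trans ?_
    refine ((E i).π_br _ _ _ _).trans ?_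
    refine Eq.trans ?_ (jointCMagma_refl E f φ i _).symm
    exact congrArg (E i).C.refl (proj_jointπGraph E f φ i c₁).symm
  br_self c hp := JointSub.ext fun i => by
    rw [JointSub.app_proj_cell, JointSub.app_proj_cell, (E i).br_self]

/-- The projections of `joint`. -/
noncomputable def jointProj (i : I) : joint E f φ ⟶ E i where
  mHom := jointMagmaProj E f φ i
  cHom := jointStrictCatProj E f φ i
  w := NMagma.Hom.ext <| InfGraph.hom_ext fun x => (proj_jointπGraph E f φ i x).symm
  map_br _ _ _ _ := JointSub.app_proj_cell _ _ _ i

/-- Both levels of `joint` are subgraphs of products. This supplies the joint monicity of the cone.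
-/
theorem joint_hom_ext {D : Stretching.{u} n} {g g' : D ⟶ joint E f φ}
    (h : ∀ i, g ≫ jointProj E f φ i = g' ≫ jointProj E f φ i) : g = g' := by
  apply Stretching.Hom.ext
  · exact NMagma.Hom.ext <| JointSub.hom_ext (S := jointM E f φ) fun i =>
      congrArg (fun k : D ⟶ E i => k.mHom.graphHom) (h i)
  · exact NMagma.Hom.ext <| JointSub.hom_ext (S := jointC E f φ) fun i =>
      congrArg (fun k : D ⟶ E i => k.cHom.graphHom) (h i)

/-- The generators of `joint`. -/
noncomputable def jointGen : X ⟶ (joint E f φ).M.graph :=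
  JointSub.lift (S := jointM E f φ) f fun x => ⟨.gen x, rfl⟩

theorem jointGen_proj (i : I) : jointGen E f φ ≫ (jointProj E f φ i).mHom.graphHom = f i :=
  JointSub.lift_proj (S := jointM E f φ) f (fun x => ⟨.gen x, rfl⟩) i

variable {E f φ}

/-- All components of a value come from one and the same term, and `k` preserves every operation in
it. Of `φ` only compatibility with `k` is needed; `φ i` need not be a morphism of stretchings, and
in the application to algebras it is just a map of `∞`-graphs. -/
theorem Tm.eval_natural {i j : I} (k : E i ⟶ E j) (hf : f i ≫ k.mHom.graphHom = f j)
    (hφ : φ i ≫ k.mHom.graphHom = k.mHom.graphHom ≫ φ j) {m : ℕ} (v : Tm X m) :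
    ∀ a ∈ v.eval E f φ, app k.mHom.graphHom (a i) = a j := by
  induction v with
  | gen x =>
    rintro _ rfl
    exact congrArg (fun g => app g x) hf
  | act v ih =>
    rintro _ ⟨a, ha, rfl⟩
    rw [← app_comp, hφ, app_comp, ih a ha]
  | face g v ih =>
    rintro _ ⟨a, ha, rfl⟩
    rw [app_face, ih a ha]
  | refl v ih =>
    rintro _ ⟨a, ha, rfl⟩
    rw [k.mHom.map_refl, ih a ha]
  | comp h v v' ih ih' =>
    rintro _ ⟨a, ha, b, hb, e, rfl⟩
    rw [k.mHom.map_comp]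
    exact Magma.comp_congr h (ih a ha) (ih' b hb) _
  | rev h v ih =>
    rintro _ ⟨a, ha, hn, rfl⟩
    rw [k.mHom.map_rev, ih a ha]
  | br v v' ih ih' =>
    rintro _ ⟨a, ha, b, hb, hp, hπ, rfl⟩
    rw [k.map_br]
    congr 1
    · exact ih a ha
    · exact ih' b hb

theorem CTm.eval_natural {i j : I} (k : E i ⟶ E j) (hf : f i ≫ k.mHom.graphHom = f j)
    (hφ : φ i ≫ k.mHom.graphHom = k.mHom.graphHom ≫ φ j) {m : ℕ} (v : CTm X m) :
    ∀ a ∈ v.eval E f φ, app k.cHom.graphHom (a i) = a j := by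
  induction v with
  | pi v =>
    rintro _ ⟨a, ha, rfl⟩
    refine (Stretching.app_square k.w (a i)).symm.trans ?_
    rw [v.eval_natural k hf hφ a ha]
  | face g v ih =>
    rintro _ ⟨a, ha, rfl⟩
    exact (app_face k.cHom.graphHom g (a i)).trans (congrArg _ (ih a ha))
  | refl v ih =>
    rintro _ ⟨a, ha, rfl⟩
    exact (k.cHom.map_refl _).trans (congrArg (E j).C.refl (ih a ha))
  | comp h v v' ih ih' =>
    rintro _ ⟨a, ha, b, hb, e, rfl⟩
    exact (k.cHom.map_comp h _ _ _).trans
      (Magma.comp_congr (M := (E j).C.toMagma) h (ih a ha) (ih' b hb) _)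
  | inv h v ih =>
    rintro _ ⟨a, ha, hn, rfl⟩
    exact (k.cHom.map_rev hn h _).trans (congrArg ((E j).C.inv hn h) (ih a ha))

theorem jointProj_natural {i j : I} (k : E i ⟶ E j) (hf : f i ≫ k.mHom.graphHom = f j)
    (hφ : φ i ≫ k.mHom.graphHom = k.mHom.graphHom ≫ φ j) :
    jointProj E f φ i ≫ k = jointProj E f φ j := by
  apply Stretching.Hom.ext
  · refine NMagma.Hom.ext <| InfGraph.hom_ext fun x => ?_
    obtain ⟨v, hv⟩ := (jointM E f φ).mem x
    exact v.eval_natural k hf hφ _ hv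
  · refine NMagma.Hom.ext <| InfGraph.hom_ext fun x => ?_
    obtain ⟨v, hv⟩ := (jointC E f φ).mem x
    exact v.eval_natural k hf hφ _ hv

end Joint

/-! ### The left adjoint of `U_n` -/

/-- The free stretching on an `∞`-graph, as an object under it. -/
noncomputable def freeStretching (n : ℕ∞) (X : InfGraph.{u}) :
    StructuredArrow X (Stretching.U.{u} n) :=
  StructuredArrow.mk (Y := joint (fun i : StructuredArrow X (Stretching.U.{u} n) => i.right)
    -- The family consists of all stretchings under `X`. No extra operation is wanted here, so `act`
    -- is interpreted by the identity.
    (fun i => i.hom) (fun i => 𝟙 i.right.M.graph)) (jointGen _ _ _)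

theorem hasInitial_structuredArrow_U (n : ℕ∞) (X : InfGraph.{u}) :
    Limits.HasInitial (StructuredArrow X (Stretching.U.{u} n)) := by
  refine hasInitial_of_jointly_monic_cone (freeStretching n X)
    (fun i => StructuredArrow.homMk (jointProj _ _ _ i) (jointGen_proj _ _ _ i)) ?_ ?_
  · intro i j h
    apply StructuredArrow.hom_ext
    refine jointProj_natural h.right (StructuredArrow.w h) ?_
    exact (Category.id_comp _).trans (Category.comp_id _).symm
  · intro g hg
    apply StructuredArrow.hom_ext
    exact joint_hom_ext _ _ _ fun i =>
      (congrArg CommaMorphism.right (hg i)).trans (Category.id_comp _).symm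

theorem Stretching.U_isRightAdjoint (n : ℕ∞) : (Stretching.U.{u} n).IsRightAdjoint :=
  have := hasInitial_structuredArrow_U.{u} n
  isRightAdjointOfStructuredArrowInitials _

/-! ### Structural induction in a free stretching -/

section FreeInduction

/-- An endomorphism of a free object that fixes the unit is the identity. It is used to split the
inclusion of a substructure containing the generators. -/
theorem homEquiv_symm_comp_eq_id {B D : Type*} [Category B] [Category D] {F : B ⥤ D} {U : D ⥤ B}
    (adj : F ⊣ U) {X : B} {Z : D} {g : X ⟶ U.obj Z} {k : Z ⟶ F.obj X}
    (h : g ≫ U.map k = adj.unit.app X) : (adj.homEquiv X Z).symm g ≫ k = 𝟙 (F.obj X) := by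
  rw [← adj.homEquiv_naturality_right_symm, h, ← adj.homEquiv_id, Equiv.symm_apply_apply]

variable {n : ℕ∞} {F : InfGraph.{u} ⥤ Stretching.{u} n} (adj : F ⊣ Stretching.U n)

/-- Induction over the cells of a free stretching. -/
theorem free_induction {X : InfGraph.{u}} {P : ∀ m, (F.obj X).M.graph.Cell m → Prop}
    (gen : ∀ {m : ℕ} (x : X.Cell m), P m (app (adj.unit.app X) x))
    (face : ∀ {p m : ℕ} (g : Globe.mk p ⟶ Globe.mk m) (x : (F.obj X).M.graph.Cell m),
      P m x → P p ((F.obj X).M.graph.face g x))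
    (refl : ∀ {m : ℕ} (x : (F.obj X).M.graph.Cell m), P m x → P (m + 1) ((F.obj X).M.refl x))
    (comp : ∀ {p m : ℕ} (h : p < m) (y x : (F.obj X).M.graph.Cell m) (e : s h y = t h x),
      P m y → P m x → P m ((F.obj X).M.comp h y x e))
    (rev : ∀ {p m : ℕ} (hn : n ≤ p) (h : p < m) (x : (F.obj X).M.graph.Cell m),
      P m x → P m ((F.obj X).M.rev hn h x))
    (br : ∀ {m : ℕ} (y x : (F.obj X).M.graph.Cell m) (hp : Parallel y x)
      (hπ : app (F.obj X).π.graphHom y = app (F.obj X).π.graphHom x),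
      P m y → P m x → P (m + 1) ((F.obj X).br y x hp hπ))
    {m : ℕ} (z : (F.obj X).M.graph.Cell m) : P m z := by
  -- For a family with one member, `joint` is the substretching generated by the unit. Since `adj`
  -- is an arbitrary adjunction, nothing is known about `F.obj X` beyond its universal property.
  let E : Unit → Stretching.{u} n := fun _ => F.obj X
  let f : ∀ i, X ⟶ (E i).M.graph := fun _ => adj.unit.app X
  let φ : ∀ i, (E i).M.graph ⟶ (E i).M.graph := fun _ => 𝟙 _
  have H {m : ℕ} (v : Tm X m) : ∀ a ∈ v.eval E f φ, P m (a ()) := by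
    induction v with
    | gen x =>
      rintro _ rfl
      exact gen x
    | act v ih =>
      rintro _ ⟨a, ha, rfl⟩
      exact ih a ha
    | face g v ih =>
      rintro _ ⟨a, ha, rfl⟩
      exact face g _ (ih a ha)
    | refl v ih =>
      rintro _ ⟨a, ha, rfl⟩
      exact refl _ (ih a ha)
    | comp h v v' ih ih' =>
      rintro _ ⟨a, ha, b, hb, e, rfl⟩
      exact comp h _ _ _ (ih a ha) (ih' b hb)
    | rev h v ih =>
      rintro _ ⟨a, ha, hn, rfl⟩
      exact rev hn h _ (ih a ha)
    | br v v' ih ih' =>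
      rintro _ ⟨a, ha, b, hb, hp, hπ, rfl⟩
      exact br _ _ _ _ (ih a ha) (ih' b hb)
  -- Freeness gives a section of the inclusion of this substretching, so every cell of `F.obj X` is
  -- the value of a term.
  let ψ : F.obj X ⟶ joint E f φ := (adj.homEquiv _ _).symm (jointGen E f φ)
  have hψ : ψ ≫ jointProj E f φ () = 𝟙 (F.obj X) :=
    homEquiv_symm_comp_eq_id adj (jointGen_proj E f φ ())
  obtain ⟨v, hv⟩ := (jointM E f φ).mem (app ψ.mHom.graphHom z)
  have := H v _ hv
  rwa [show app ((jointM E f φ).proj ()) (app ψ.mHom.graphHom z) = z from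
    congrArg (fun k : F.obj X ⟶ F.obj X => app k.mHom.graphHom z) hψ] at this

end FreeInduction

/-! ### Left adjoints of the functors between categories of algebras -/

section Algebras

variable {n : ℕ∞} {F : InfGraph.{u} ⥤ Stretching.{u} n} {adj : F ⊣ Stretching.U n}
  {T' : Monad InfGraph.{u}} (θ : T' ⟶ adj.toMonad) (A : T'.Algebra)

namespace InitialAlgebra

/-- The objects under `A`. -/
noncomputable abbrev Index := StructuredArrow A (Monad.algebraFunctorOfMonadHom θ)

variable {θ A}

/-- The stretching on the carrier of an algebra under `A`. -/
noncomputable abbrev E (i : Index θ A) : Stretching.{u} n := F.obj i.right.A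

/-- The morphism from the carrier of `A`. -/
noncomputable def base (i : Index θ A) : A.A ⟶ i.right.A := i.hom.f

/-- The structure morphism of an algebra under `A`. -/
noncomputable def str (i : Index θ A) : (E i).M.graph ⟶ i.right.A := i.right.a

/-- The unit at the carrier of an algebra under `A`. -/
noncomputable def unit (i : Index θ A) : i.right.A ⟶ (E i).M.graph := adj.unit.app i.right.A

theorem unit_str (i : Index θ A) : unit i ≫ str i = 𝟙 i.right.A := i.right.unit

variable (θ A)

/-- The values in all algebras under `A` of terms over `A`. -/
noncomputable def terms : JointSub fun i : Index θ A => (E i).M.graph :=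
  jointM E (fun i => base i ≫ unit i) (fun i => str i ≫ unit i)

/-- The carrier of the initial algebra under `A`. -/
noncomputable def sub : JointSub fun i : Index θ A => i.right.A where
  -- Terms take values in the free stretchings on the algebras; the structure maps bring these
  -- values back to the carriers.
  carrier m := (fun a i => app (str i) (a i)) '' (terms θ A).carrier m
  small m := have := (terms θ A).small m; inferInstance
  face_mem := by
    rintro p m g _ ⟨a, ha, rfl⟩
    exact ⟨_, (terms θ A).face_mem g ha, funext fun i => app_face _ _ _⟩

/-- This is what closes `sub` under the algebra structures: applying `str i` to these tuples lands
in `sub` by definition. The operations of a stretching are preserved by `F.map`, so only the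
generators need an argument. -/
theorem map_proj_mem {m : ℕ} (z : (F.obj (sub θ A).graph).M.graph.Cell m) :
    (fun i => app (F.map ((sub θ A).proj i)).mHom.graphHom z) ∈ (terms θ A).carrier m := by
  refine free_induction adj (P := fun m z =>
    (fun i => app (F.map ((sub θ A).proj i)).mHom.graphHom z) ∈ (terms θ A).carrier m)
    ?_ ?_ ?_ ?_ ?_ ?_ z
  -- A cell of `sub` has components `str i (a i)` for a term value `a`, so its unit has components
  -- `unit i (str i (a i))`, the value of an `act` term.
  · intro m x
    obtain ⟨a, ⟨v, hv⟩, h⟩ := (sub θ A).mem x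
    refine ⟨.act v, a, hv, funext fun i => ?_⟩
    have h' : app (unit i) (app (str i) (a i)) = app (unit i) (app ((sub θ A).proj i) x) :=
      congrArg _ (congrFun h i)
    refine Eq.trans ?_ h'.symm
    exact congrArg (fun k => app k x) (adj.unit.naturality ((sub θ A).proj i)).symm
  · intro p m g x hx
    obtain ⟨v, hv⟩ := hx
    exact ⟨.face g v, _, hv, funext fun i => app_face _ _ _⟩
  · intro m x hx
    obtain ⟨v, hv⟩ := hx
    exact ⟨.refl v, _, hv, funext fun i => (F.map ((sub θ A).proj i)).mHom.map_refl x⟩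
  · intro p m h y x e hy hx
    obtain ⟨v, hv⟩ := hy
    obtain ⟨w, hw⟩ := hx
    exact ⟨.comp h v w, _, hv, _, hw, _,
      funext fun i => (F.map ((sub θ A).proj i)).mHom.map_comp h y x e⟩
  · intro p m hn h x hx
    obtain ⟨v, hv⟩ := hx
    exact ⟨.rev h v, _, hv, hn, funext fun i => (F.map ((sub θ A).proj i)).mHom.map_rev hn h x⟩
  · intro m y x hp hπ hy hx
    obtain ⟨v, hv⟩ := hy
    obtain ⟨w, hw⟩ := hx
    exact ⟨.br v w, _, hv, _, hw, _, _,
      funext fun i => (F.map ((sub θ A).proj i)).map_br y x hp hπ⟩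

/-- The structure morphism of the initial algebra under `A`. -/
noncomputable def act : adj.toMonad.obj (sub θ A).graph ⟶ (sub θ A).graph :=
  JointSub.lift (fun i => adj.toMonad.map ((sub θ A).proj i) ≫ i.right.a)
    fun z => ⟨_, map_proj_mem θ A z, rfl⟩

theorem act_proj (i : Index θ A) :
    act θ A ≫ (sub θ A).proj i = adj.toMonad.map ((sub θ A).proj i) ≫ i.right.a :=
  JointSub.lift_proj (S := sub θ A) _ (fun z => ⟨_, map_proj_mem θ A z, rfl⟩) i

/-- The initial algebra under `A`. -/
noncomputable def algebra : adj.toMonad.Algebra where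
  A := (sub θ A).graph
  a := act θ A
  unit := JointSub.hom_ext fun i => by
    have h : adj.toMonad.η.app (sub θ A).graph ≫ adj.toMonad.map ((sub θ A).proj i) =
      (sub θ A).proj i ≫ adj.toMonad.η.app i.right.A :=
      (adj.toMonad.η.naturality ((sub θ A).proj i)).symm
    rw [Category.assoc, act_proj, reassoc_of% h, i.right.unit]
    exact (Category.comp_id _).trans (Category.id_comp _).symm
  assoc := JointSub.hom_ext fun i => by
    have h : adj.toMonad.μ.app (sub θ A).graph ≫ adj.toMonad.map ((sub θ A).proj i) =
      adj.toMonad.map (adj.toMonad.map ((sub θ A).proj i)) ≫ adj.toMonad.μ.app i.right.A :=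
      (adj.toMonad.μ.naturality ((sub θ A).proj i)).symm
    rw [Category.assoc, act_proj, reassoc_of% h, i.right.assoc, Category.assoc, act_proj,
      ← Functor.map_comp_assoc, ← Functor.map_comp_assoc, act_proj]

/-- The projections of the initial algebra under `A`. -/
noncomputable def algebraProj (i : Index θ A) : algebra θ A ⟶ i.right where
  f := (sub θ A).proj i
  h := (act_proj θ A i).symm

/-- The generator `x` has value `unit i (base i x)`, and the structure map cancels the unit. -/
theorem base_mem {m : ℕ} (x : A.A.Cell m) :
    (fun i : Index θ A => app (base i) x) ∈ (sub θ A).carrier m :=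
  ⟨_, ⟨.gen x, rfl⟩, funext fun i => congrArg (fun k => app k (app (base i) x)) (unit_str i)⟩

/-- The morphism from `A` to the carrier of the initial algebra under `A`. -/
noncomputable def baseLift : A.A ⟶ (sub θ A).graph :=
  JointSub.lift base (base_mem θ A)

theorem baseLift_proj (i : Index θ A) : baseLift θ A ≫ (sub θ A).proj i = base i :=
  JointSub.lift_proj (S := sub θ A) _ (base_mem θ A) i

/-- The initial object under `A`. -/
noncomputable def initial : Index θ A :=
  StructuredArrow.mk (Y := algebra θ A)
    { f := baseLift θ A
      h := JointSub.hom_ext fun i => by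
        have h : T'.map (base i) ≫ θ.app i.right.A ≫ i.right.a = A.a ≫ base i := i.hom.h
        have h' : T'.map ((sub θ A).proj i) ≫ θ.app i.right.A =
          θ.app (sub θ A).graph ≫ adj.toMonad.map ((sub θ A).proj i) :=
          θ.naturality ((sub θ A).proj i)
        change (T'.map (baseLift θ A) ≫ θ.app (sub θ A).graph ≫ act θ A) ≫ (sub θ A).proj i =
          (A.a ≫ baseLift θ A) ≫ (sub θ A).proj i
        rw [Category.assoc, Category.assoc, act_proj, ← reassoc_of% h', Category.assoc,
          baseLift_proj, ← h, ← Functor.map_comp_assoc, baseLift_proj] }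

/-- A morphism of algebras lifts along `F` to a morphism of stretchings that commutes with units and
structure maps. So `Tm.eval_natural` applies upstairs, and `str` carries the result down. -/
theorem proj_natural {i j : Index θ A} (h : i ⟶ j) :
    (sub θ A).proj i ≫ h.right.f = (sub θ A).proj j := by
  refine InfGraph.hom_ext fun x => ?_
  obtain ⟨a, ⟨v, hv⟩, hx⟩ := (sub θ A).mem x
  have hf : base i ≫ h.right.f = base j := congrArg Monad.Algebra.Hom.f (StructuredArrow.w h)
  have hu : unit i ≫ (F.map h.right.f).mHom.graphHom = h.right.f ≫ unit j :=
    (adj.unit.naturality h.right.f).symm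
  have hs : (F.map h.right.f).mHom.graphHom ≫ str j = str i ≫ h.right.f := h.right.h
  have key := v.eval_natural (F.map h.right.f) (i := i) (j := j)
    (by rw [Category.assoc, hu, reassoc_of% hf])
    (by rw [Category.assoc, hu, reassoc_of% hs]) a hv
  rw [app_comp, ← congrFun hx i, ← congrFun hx j]
  refine Eq.trans ?_ (congrArg (app (str j)) key)
  exact congrArg (fun k => app k (a i)) hs.symm

theorem hasInitial : Limits.HasInitial (Index θ A) := by
  refine hasInitial_of_jointly_monic_cone (initial θ A)
    (fun i => StructuredArrow.homMk (algebraProj θ A i)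
      (Monad.Algebra.Hom.ext (baseLift_proj θ A i))) ?_ ?_
  · intro i j h
    apply StructuredArrow.hom_ext
    exact Monad.Algebra.Hom.ext (proj_natural θ A h)
  · intro g hg
    apply StructuredArrow.hom_ext
    refine Monad.Algebra.Hom.ext (JointSub.hom_ext (S := sub θ A) fun i => ?_)
    exact (congrArg (fun k => k.right.f) (hg i)).trans (Category.id_comp _).symm

end InitialAlgebra

/-- Only the monad `adj.toMonad` must come from stretchings, while `T'` is arbitrary; hence `V_n`
and `V` are treated at once. -/
theorem algebraFunctorOfMonadHom_isRightAdjoint :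
    (Monad.algebraFunctorOfMonadHom θ).IsRightAdjoint :=
  have := InitialAlgebra.hasInitial θ
  isRightAdjointOfStructuredArrowInitials _

end Algebras

end WeakCat

theorem mainTheorem5 :
    -- the forgetful functors `U_n` (for `n = ∞`: Penon's) have left adjoints
    (∀ n : ℕ∞, (WeakCat.Stretching.U.{u} n).IsRightAdjoint) ∧
    -- for any choice of adjunctions `F_n ⊣ U_n`, `F_{n+1} ⊣ U_{n+1}`, `F_P ⊣ U_P` generating
    -- the monads `T^n`, `T^{n+1}`, `T^P`
    ∀ (n : ℕ) (F : WeakCat.InfGraph.{u} ⥤ WeakCat.Stretching.{u} (n : ℕ∞))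
      (F' : WeakCat.InfGraph.{u} ⥤ WeakCat.Stretching.{u} ((n : ℕ∞) + 1))
      (FP : WeakCat.InfGraph.{u} ⥤ WeakCat.Stretching.{u} ⊤)
      (adj : F ⊣ WeakCat.Stretching.U.{u} (n : ℕ∞))
      (adj' : F' ⊣ WeakCat.Stretching.U.{u} ((n : ℕ∞) + 1))
      (adjP : FP ⊣ WeakCat.Stretching.U.{u} ⊤),
      -- `V_n : Alg(T^n) ⥤ Alg(T^{n+1})` lies over `∞-Gr` and has a left adjoint
      (WeakCat.V le_self_add adj adj' ⋙ (WeakCat.T adj').forget = (WeakCat.T adj).forget ∧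
        (WeakCat.V le_self_add adj adj').IsRightAdjoint) ∧
      -- `V : Alg(T^n) ⥤ Alg(T^P)` lies over `∞-Gr` and has a left adjoint
      (WeakCat.V le_top adj adjP ⋙ (WeakCat.T adjP).forget = (WeakCat.T adj).forget ∧
        (WeakCat.V le_top adj adjP).IsRightAdjoint) :=
  ⟨WeakCat.Stretching.U_isRightAdjoint, fun _ _ _ _ _ _ _ =>
    -- Restriction along a morphism of monads leaves the carriers and the underlying maps unchanged.
    ⟨⟨rfl, WeakCat.algebraFunctorOfMonadHom_isRightAdjoint _⟩,
      ⟨rfl, WeakCat.algebraFunctorOfMonadHom_isRightAdjoint _⟩⟩⟩
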